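/- Let $M$ be a convenient ($c^\infty$-complete, Kriegl–Michor) manifold modelled on a convenient vector space $\mathbb{E}$, with kinematic tangent bundle $TM$ and kinematic cotangent bundle $T'M$. Let $\mathbb{E}^\flat$ be a linear subspace of the bornological dual $\mathbb{E}'$, endowed with its own convenient structure such that the inclusion $\mathbb{E}^\flat\to\mathbb{E}'$ is bounded, and let $T^\flat M\subseteq T'M$ be a weak subbundle with typical fibre $\mathbb{E}^\flat$: around each point there is a chart $U\cong\phi(U)\subseteq\mathbb{E}$ of $M$ in which the inclusion $T^\flat M\subseteq T'M$ corresponds to $\phi(U)\times\mathbb{E}^\flat\subseteq \phi(U)\times\mathbb{E}'$ (call such charts adapted), and the induced changes of coordinates on $\mathbb{E}^\flat$ between such charts are smooth. For $U\subseteq M$ open, let $\mathfrak{A}(U)$ be the set of $f\in C^\infty(U)$ such that, in adapted charts and for every $k\ge1$, $d^k_xf(\cdot,u_2,\dots,u_k)\in T^\flat_xM$ for all $x\in U$ and $u_2,\dots,u_k\in T_xM$, the resulting map $(x,u_2,\dots,u_k)\mapsto d^k_xf(\cdot,u_2,\dots,u_k)$ into $T^\flat M$ being smooth. Let $\mathfrak{P}$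 be the sheaf of $\mathfrak{A}$-modules of sections of $T^\flat M$ generated by the differentials $df$, $f\in\mathfrak{A}(U)$. An almost Poisson anchor is a smooth bundle morphism $P:T^\flat M\to TM$ over $\mathrm{id}_M$ with $\langle\xi,P\eta\rangle=-\langle\eta,P\xi\rangle$ for all $\xi,\eta\in T^\flat_xM$, $x\in M$. For $f\in\mathfrak{A}(U)$ and $g\in C^\infty(U)$ put $\{f,g\}_P=\langle dg,P(df)\rangle$ (so $\{f,g\}_P=-\langle df,P(dg)\rangle$ if also $g\in\mathfrak{A}(U)$). $P$ is a partial Poisson anchor if moreover, for every open $U\subseteq M$ and all $f,g,h\in\mathfrak{A}(U)$, $$\{f,\{g,h\}_P\}_P+\{g,\{h,f\}_P\}_P+\{h,\{f,g\}_P\}_P=0 .$$ For almost Poisson anchors $P,Q:T^\flat M\to TM$ the Schouten bracket $[\tilde P,\tilde Q]$ is the tensor given, for $\sigma_1,\sigma_2,\sigma_3\in\mathfrak{P}(U)$, by $$[\tilde P,\tilde Q](\sigma_1,\sigma_2,\sigma_3)=\sum_{\mathrm{cyc}(1,2,3)}\Big(\langle L_{P\sigma_1}\sigma_2,Q\sigma_3\rangle+\langle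 L_{Q\sigma_1}\sigma_2,P\sigma_3\rangle\Big),\qquad \langle L_X\sigma,Y\rangle=X\langle\sigma,Y\rangle-\langle\sigma,[X,Y]\rangle .$$ Theorem. Let $P,Q:T^\flat M\to TM$ be two partial Poisson anchors. Then $P$ and $Q$ are compatible, i.e. $P+Q$ is again a partial Poisson anchor, if and only if $[\tilde P,\tilde Q]=0$, i.e. $[\tilde P,\tilde Q](\sigma_1,\sigma_2,\sigma_3)=0$ on $U$ for every open $U\subseteq M$ and all $\sigma_1,\sigma_2,\sigma_3\in\mathfrak{P}(U)$. -/

import Mathlib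

open Set Filter Topology

/-! ## Convenient calculus -/

/-- A convenient (`c^∞`-complete) vector space: a Hausdorff locally convex real topological vector
space in which every Mackey-Cauchy sequence converges. -/
class ConvenientSpace (E : Type*) [AddCommGroup E] [Module ℝ E] [TopologicalSpace E] : Prop
    extends IsTopologicalAddGroup E, ContinuousSMul ℝ E, LocallyConvexSpace ℝ E, T2Space E where
  mackey_complete : ∀ x : ℕ → E,
    (∃ B : Set E, Bornology.IsVonNBounded ℝ B ∧ AbsConvex ℝ B ∧
      ∀ ε : ℝ, 0 < ε → ∃ N : ℕ, ∀ n m : ℕ, N < m → m < n → ∃ b ∈ B, x m - x n = ε • b) →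
    ∃ l : E, Tendsto x atTop (𝓝 l)

section Calculus

variable {E : Type*} [AddCommGroup E] [Module ℝ E] [TopologicalSpace E]
variable {F : Type*} [AddCommGroup F] [Module ℝ F] [TopologicalSpace F]

/-- A curve `c : ℝ → E` is smooth if all its iterated derivatives exist (the sequence `d` lists
them, derivatives being limits of difference quotients in `E`). -/
def SmoothCurve (c : ℝ → E) : Prop :=
  ∃ d : ℕ → ℝ → E, d 0 = c ∧
    ∀ (n : ℕ) (t : ℝ),
      Tendsto (fun h : ℝ => h⁻¹ • (d n (t + h) - d n t)) (𝓝[≠] 0) (𝓝 (d (n + 1) t))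

/-- Open sets of the `c^∞`-topology, the final topology for all smooth curves `ℝ → E`. -/
def CInftyOpen (U : Set E) : Prop :=
  ∀ c : ℝ → E, SmoothCurve c → IsOpen (c ⁻¹' U)

/-- `f` is (conveniently) smooth on the `c^∞`-open set `U`: it maps smooth curves in `U` to smooth
curves. -/
def CSmoothOn (U : Set E) (f : E → F) : Prop :=
  ∀ c : ℝ → E, SmoothCurve c → (∀ t, c t ∈ U) → SmoothCurve (f ∘ c)

/-- The differential `df(x)v = lim_{t → 0} (f(x + t v) - f(x)) / t`. -/
noncomputable def cdiff (f : E → F) (x v : E) : F :=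
  limUnder (𝓝[≠] (0 : ℝ)) (fun t : ℝ => t⁻¹ • (f (x + t • v) - f x))

/-- The iterated differential `d^k f(x)(u_0, …, u_{k-1})`. -/
noncomputable def iteratedCdiff (f : E → ℝ) : (k : ℕ) → E → (Fin k → E) → ℝ
  | 0, x, _ => f x
  | k + 1, x, u => cdiff (fun y => iteratedCdiff f k y (Fin.tail u)) x (u 0)

end Calculus

/-! ## Convenient manifolds -/

section Manifold

variable {E : Type*} [AddCommGroup E] [Module ℝ E] [TopologicalSpace E]
variable {M : Type*}

/-- The change of charts `e' ∘ e⁻¹` is a smooth map defined on a `c^∞`-open subset of `E`. -/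
def SmoothTransition (e e' : PartialEquiv M E) : Prop :=
  CInftyOpen (e.symm.trans e').source ∧ CSmoothOn (e.symm.trans e').source (e' ∘ e.symm)

variable (E M) in
/-- A convenient manifold: a set `M` with a smooth atlas modelled on the convenient space `E`. -/
structure ConvenientManifold where
  atlas : Set (PartialEquiv M E)
  cover : ∀ x : M, ∃ e ∈ atlas, x ∈ e.source
  target_open : ∀ e ∈ atlas, CInftyOpen e.target
  compatible : ∀ e ∈ atlas, ∀ e' ∈ atlas, SmoothTransition e e'

/-- All the charts that are compatible with the atlas. -/
def ConvenientManifold.maximalAtlas (𝓜 : ConvenientManifold E M) : Set (PartialEquiv M E) :=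
  {e | CInftyOpen e.target ∧ ∀ a ∈ 𝓜.atlas, SmoothTransition e a ∧ SmoothTransition a e}

/-- Open subsets of `M`, for the topology that makes the charts homeomorphisms onto `c^∞`-open
sets. -/
def ConvenientManifold.IsOpenSet (𝓜 : ConvenientManifold E M) (U : Set M) : Prop :=
  ∀ e ∈ 𝓜.atlas, CInftyOpen (e.target ∩ e.symm ⁻¹' U)

/-- `f ∈ C^∞(U)` (only the values of `f` on `U` matter). -/
def ConvenientManifold.SmoothFun (𝓜 : ConvenientManifold E M) (U : Set M) (f : M → ℝ) : Prop :=
  ∀ e ∈ 𝓜.atlas, CSmoothOn (e.target ∩ e.symm ⁻¹' U) (f ∘ e.symm)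

end Manifold

/-! ## Weak subbundles of the kinematic cotangent bundle -/

section Bundle

variable {E : Type*} [AddCommGroup E] [Module ℝ E] [TopologicalSpace E]
variable {F : Type*} [AddCommGroup F] [Module ℝ F] [TopologicalSpace F]
variable {M : Type*}

variable (F) in
/-- A weak subbundle `T^♭M → M` of the kinematic cotangent bundle `T'M → M`.

Its typical fibre `F = E^♭` is a linear subspace of the bornological dual `E'`, with its own
convenient structure and with bounded inclusion `F → E'`: this is recorded by the duality pairing
`F × E → ℝ`, which is nondegenerate on the left and bounded.  Around each point there is a chart
`e` of `M` in which the inclusion `T^♭M ⊆ T'M` reads `e.target × F ⊆ e.target × E'`, and the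
changes of coordinates of `T'M` between two such charts restrict to smooth changes of coordinates
of `T^♭M`. -/
structure WeakSubbundle (𝓜 : ConvenientManifold E M) where
  pairing : F →ₗ[ℝ] E →ₗ[ℝ] ℝ
  pairing_injective : Function.Injective pairing
  pairing_bounded : ∀ (A : Set F) (B : Set E), Bornology.IsVonNBounded ℝ A →
    Bornology.IsVonNBounded ℝ B → ∃ C : ℝ, ∀ ξ ∈ A, ∀ v ∈ B, |pairing ξ v| ≤ C
  charts : Set (PartialEquiv M E)
  charts_subset : charts ⊆ 𝓜.maximalAtlas
  cover : ∀ x : M, ∃ e ∈ charts, x ∈ e.source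
  transition : ∀ e ∈ charts, ∀ e' ∈ charts, ∃ τ : E × F → F,
    CSmoothOn ((e.symm.trans e').source ×ˢ univ) τ ∧
    ∀ y ∈ (e.symm.trans e').source, ∀ (ξ : F) (v : E),
      pairing (τ (y, ξ)) v = pairing ξ (cdiff (e' ∘ e.symm) y v)

namespace WeakSubbundle

variable {𝓜 : ConvenientManifold E M} (T : WeakSubbundle F 𝓜)

/-- A chosen chart around `x` adapted to `T^♭M`.  It identifies the kinematic tangent space `T_xM`
with `E` and the fibre `T^♭_xM` with `F`; elements of these fibres are given below by
their coordinates in this chart. -/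
noncomputable def chartAt (x : M) : PartialEquiv M E := Classical.choose (T.cover x)

/-- The element of `F` that represents the linear form `ℓ` (when `ℓ` lies in `F ⊆ E'`). -/
noncomputable def lift (ℓ : E → ℝ) : F :=
  Function.invFun (fun (ξ : F) (v : E) => T.pairing ξ v) ℓ

/-- The tangent map `T_xM → E` of a chart `e`, that is, the coordinates in `e` of `v ∈ T_xM`. -/
noncomputable def tangentCoord (e : PartialEquiv M E) (x : M) (v : E) : E :=
  cdiff (e ∘ (T.chartAt x).symm) (T.chartAt x x) v

/-- The element of `T^♭_xM` whose coordinates in the adapted chart `e` are `ξ`. -/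
noncomputable def cotangentOfCoord (e : PartialEquiv M E) (x : M) (ξ : F) : F :=
  T.lift (fun v => T.pairing ξ (T.tangentCoord e x v))

/-- The derivative `d_xf(v)` of a function on `M` in the direction `v ∈ T_xM`. -/
noncomputable def dfun (f : M → ℝ) (x : M) (v : E) : ℝ :=
  cdiff (f ∘ (T.chartAt x).symm) (T.chartAt x x) v

/-- `d_xf` as an element of `T^♭_xM` (when it belongs to it). -/
noncomputable def dflat (f : M → ℝ) (x : M) : F := T.lift (T.dfun f x)

/-- The set `𝔄(U)` of the `f ∈ C^∞(U)` such that, for each `k ≥ 1`, the form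
`d^k_xf(·, u_2, …, u_k)` belongs to `T^♭_xM`, smoothly in `(x, u_2, …, u_k)`; derivatives are
taken in the adapted charts. -/
def InA (U : Set M) (f : M → ℝ) : Prop :=
  𝓜.SmoothFun U f ∧
    ∀ e ∈ T.charts, ∀ k : ℕ, ∃ G : E × (Fin k → E) → F,
      CSmoothOn ((e.target ∩ e.symm ⁻¹' U) ×ˢ univ) G ∧
      ∀ y ∈ e.target ∩ e.symm ⁻¹' U, ∀ (u : Fin k → E) (v : E),
        T.pairing (G (y, u)) v = iteratedCdiff (f ∘ e.symm) (k + 1) y (Fin.cons v u)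

/-- Sections over `U` of the sheaf `𝔓` of `𝔄`-modules generated by the `df`, `f ∈ 𝔄`: sections of
`T^♭M` that are locally finite sums `∑ a_i df_i` with `a_i` and `f_i` in `𝔄`. -/
def InP (U : Set M) (σ : M → F) : Prop :=
  ∀ x ∈ U, ∃ W : Set M, 𝓜.IsOpenSet W ∧ x ∈ W ∧ W ⊆ U ∧
    ∃ (n : ℕ) (a f : Fin n → M → ℝ), (∀ i, T.InA W (a i)) ∧ (∀ i, T.InA W (f i)) ∧
      ∀ y ∈ W, σ y = ∑ i, a i y • T.dflat (f i) y

/-! ### Anchors -/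

/-- An almost Poisson anchor `P : T^♭M → TM`: a smooth bundle morphism (its expression in each
adapted chart is smooth) that is antisymmetric, `⟨ξ, P η⟩ = -⟨η, P ξ⟩`. -/
def IsAlmostPoissonAnchor (P : M → F →ₗ[ℝ] E) : Prop :=
  (∀ e ∈ T.charts, CSmoothOn (e.target ×ˢ (univ : Set F))
    (fun p : E × F =>
      T.tangentCoord e (e.symm p.1) (P (e.symm p.1) (T.cotangentOfCoord e (e.symm p.1) p.2)))) ∧
  ∀ (x : M) (ξ η : F), T.pairing ξ (P x η) = - T.pairing η (P x ξ)

/-- The bracket `{f, g}_P = ⟨dg, P(df)⟩`, for `f ∈ 𝔄(U)` and `g ∈ C^∞(U)`.  For `f, g ∈ 𝔄(U)` and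
`P` antisymmetric it equals `-⟨df, P(dg)⟩`. -/
noncomputable def bracket (P : M → F →ₗ[ℝ] E) (f g : M → ℝ) : M → ℝ :=
  fun x => T.dfun g x (P x (T.dflat f x))

/-- A partial Poisson anchor: an almost Poisson anchor whose bracket satisfies the Jacobi identity
on `𝔄(U)`, for every open subset `U` of `M`. -/
def IsPartialPoissonAnchor (P : M → F →ₗ[ℝ] E) : Prop :=
  T.IsAlmostPoissonAnchor P ∧
  ∀ U : Set M, 𝓜.IsOpenSet U → ∀ f g h : M → ℝ, T.InA U f → T.InA U g → T.InA U h →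
    ∀ x ∈ U,
      T.bracket P f (T.bracket P g h) x + T.bracket P g (T.bracket P h f) x
        + T.bracket P h (T.bracket P f g) x = 0

/-- Two partial Poisson anchors are compatible if their sum is again a partial Poisson anchor. -/
def Compatible (P Q : M → F →ₗ[ℝ] E) : Prop := T.IsPartialPoissonAnchor (P + Q)

/-! ### The Schouten bracket -/

/-- The expression of a vector field `X` in the chart `e`. -/
noncomputable def fieldInChart (e : PartialEquiv M E) (X : M → E) : E → E :=
  fun y => T.tangentCoord e (e.symm y) (X (e.symm y))

/-- The Lie bracket of vector fields, in charts `[X, Y] = dY(X) - dX(Y)`. -/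
noncomputable def lieBracket (X Y : M → E) : M → E := fun x =>
  cdiff (T.fieldInChart (T.chartAt x) Y) (T.chartAt x x) (X x)
    - cdiff (T.fieldInChart (T.chartAt x) X) (T.chartAt x x) (Y x)

/-- `⟨L_X σ, Y⟩ = X(⟨σ, Y⟩) - ⟨σ, [X, Y]⟩`, the Lie derivative of a section `σ` of `T^♭M` along
the vector field `X`, evaluated on the vector field `Y`. -/
noncomputable def lieDerivative (X : M → E) (σ : M → F) (Y : M → E) : M → ℝ := fun x =>
  T.dfun (fun z => T.pairing (σ z) (Y z)) x (X x) - T.pairing (σ x) (T.lieBracket X Y x)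

/-- The vector field `Pσ`. -/
def applySection (P : M → F →ₗ[ℝ] E) (σ : M → F) : M → E := fun x => P x (σ x)

/-- The cyclic summand of the Schouten bracket,
`⟨L_{Pσ₁} σ₂, Qσ₃⟩ + ⟨L_{Qσ₁} σ₂, Pσ₃⟩`. -/
noncomputable def schoutenTerm (P Q : M → F →ₗ[ℝ] E) (σ₁ σ₂ σ₃ : M → F) : M → ℝ := fun x =>
  T.lieDerivative (applySection P σ₁) σ₂ (applySection Q σ₃) x
    + T.lieDerivative (applySection Q σ₁) σ₂ (applySection P σ₃) x

/-- The Schouten bracket `[P̃, Q̃]`, symmetric and bilinear in `(P, Q)`, evaluated on three sections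
of `𝔓`.  For `P = Q` it is twice the cyclic sum of the `⟨L_{Pσ₁} σ₂, Pσ₃⟩`. -/
noncomputable def schouten (P Q : M → F →ₗ[ℝ] E) (σ₁ σ₂ σ₃ : M → F) : M → ℝ := fun x =>
  T.schoutenTerm P Q σ₁ σ₂ σ₃ x + T.schoutenTerm P Q σ₂ σ₃ σ₁ x + T.schoutenTerm P Q σ₃ σ₁ σ₂ x

/-- `[P̃, Q̃] = 0`: the bracket vanishes on all local sections of `𝔓`. -/
def SchoutenVanishes (P Q : M → F →ₗ[ℝ] E) : Prop :=
  ∀ U : Set M, 𝓜.IsOpenSet U → ∀ σ₁ σ₂ σ₃ : M → F, T.InP U σ₁ → T.InP U σ₂ → T.InP U σ₃ →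
    ∀ x ∈ U, T.schouten P Q σ₁ σ₂ σ₃ x = 0

end WeakSubbundle

end Bundle

/-! Fix a point `x` and the adapted chart chosen there; an anchor `R` then has a value `R x` and a
derivative `anchorDeriv`. Differentiating `⟨dh, R dg⟩` along `R df` gives one term containing the
derivative of `R` and two Hessian terms. In the cyclic sum the Hessian terms cancel, because `R` is
antisymmetric and Hessians are symmetric (`jacobiator_eq`). What remains is quadratic in the first
jet of `R`. By polarization the Jacobiator of `P + Q` is the sum of those of `P` and `Q`, which
vanish, and of a mixed term `crossForm` (`jacobiator_add`).

Expanding the Lie derivatives shows that the Schouten bracket is the same `crossForm`, evaluated on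
the values of the sections; the derivatives of the sections cancel by antisymmetry alone
(`schouten_eq_crossForm`). So compatibility says that `crossForm` vanishes on differentials of
functions of `𝔄`, and `[P̃, Q̃] = 0` that it vanishes on values of sections of `𝔓`. Differentials
are such sections, and conversely these values lie in the linear span of the differentials, so
trilinearity (`crossForm_eq_zero_of_span`) finishes.

Most of the work is calculus. Smoothness is tested only along curves, so linearity of `cdiff`, the
chain rule and the symmetry of second derivatives must be derived from that. The tool is a smooth
curve through short segments at rapidly converging points (`exists_special_curve`): along it a
smooth function obeys first and second difference estimates, which then hold at these points of `E`.
The pairing is only bounded, so its Leibniz rule (`hasDerivAt_bilin`) rests on bounded second order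
Taylor remainders. -/

set_option linter.unusedSectionVars false

/-! ### Differentiable and smooth curves -/

section CurveCalculus

variable {E : Type*} [AddCommGroup E] [Module ℝ E] [TopologicalSpace E]
variable {F : Type*} [AddCommGroup F] [Module ℝ F] [TopologicalSpace F]

/-- The curve `c` has the derivative `v` at `t`. -/
def HasCurveDeriv (c : ℝ → E) (v : E) (t : ℝ) : Prop :=
  Tendsto (fun h : ℝ => h⁻¹ • (c (t + h) - c t)) (𝓝[≠] 0) (𝓝 v)

lemma hasCurveDeriv_iff_hasDerivAt {c : ℝ → ℝ} {v t : ℝ} :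
    HasCurveDeriv c v t ↔ HasDerivAt c v t :=
  hasDerivAt_iff_tendsto_slope_zero.symm

namespace HasCurveDeriv

lemma unique [T2Space E] {c : ℝ → E} {v w : E} {t : ℝ} (hv : HasCurveDeriv c v t)
    (hw : HasCurveDeriv c w t) : v = w :=
  tendsto_nhds_unique hv hw

lemma congr {c d : ℝ → E} {v : E} {t : ℝ} (hc : HasCurveDeriv c v t) (h : c =ᶠ[𝓝 t] d) :
    HasCurveDeriv d v t := by
  refine Tendsto.congr' ?_ hc
  have h1 : Tendsto (fun h : ℝ => t + h) (𝓝[≠] 0) (𝓝 t) := by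
    have : Tendsto (fun h : ℝ => t + h) (𝓝 0) (𝓝 (t + 0)) := tendsto_id.const_add t
    rw [add_zero] at this
    exact this.mono_left nhdsWithin_le_nhds
  filter_upwards [h1.eventually h] with s hs
  rw [hs, h.eq_of_nhds]

lemma map {c : ℝ → E} {v : E} {t : ℝ} (hc : HasCurveDeriv c v t) (L : E →L[ℝ] F) :
    HasCurveDeriv (fun s => L (c s)) (L v) t := by
  have := (L.continuous.tendsto v).comp hc
  simpa [HasCurveDeriv, Function.comp_def] using this

lemma prodMk {c : ℝ → E} {v : E} {d : ℝ → F} {w : F} {t : ℝ} (hc : HasCurveDeriv c v t)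
    (hd : HasCurveDeriv d w t) : HasCurveDeriv (fun s => (c s, d s)) (v, w) t := by
  simpa [HasCurveDeriv] using hc.prodMk_nhds hd

variable [IsTopologicalAddGroup E] [ContinuousSMul ℝ E]

lemma const (v : E) (t : ℝ) : HasCurveDeriv (fun _ => v) 0 t := by
  simpa [HasCurveDeriv] using tendsto_const_nhds

lemma add {c d : ℝ → E} {v w : E} {t : ℝ} (hc : HasCurveDeriv c v t) (hd : HasCurveDeriv d w t) :
    HasCurveDeriv (fun s => c s + d s) (v + w) t := by
  refine (Tendsto.add hc hd).congr fun h => ?_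
  rw [← smul_add, add_sub_add_comm]

lemma smul_const {φ : ℝ → ℝ} {a t : ℝ} (hφ : HasDerivAt φ a t) (v : E) :
    HasCurveDeriv (fun s => φ s • v) (a • v) t := by
  refine (Tendsto.smul_const (hasCurveDeriv_iff_hasDerivAt.2 hφ) v).congr fun h => ?_
  rw [← sub_smul, smul_smul, smul_eq_mul]

lemma const_smul {c : ℝ → E} {v : E} {t : ℝ} (hc : HasCurveDeriv c v t) (a : ℝ) :
    HasCurveDeriv (fun s => a • c s) (a • v) t := by
  refine (Tendsto.const_smul hc a).congr fun h => ?_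
  rw [smul_comm, smul_sub]

/-- The slope of `c` at `t`, extended by the derivative. -/
lemma exists_slope {c : ℝ → E} {v : E} {t : ℝ} (hc : HasCurveDeriv c v t) :
    ∃ q : ℝ → E, Tendsto q (𝓝 0) (𝓝 v) ∧ ∀ h, c (t + h) = c t + h • q h := by
  classical
  refine ⟨fun h => if h = 0 then v else h⁻¹ • (c (t + h) - c t), ?_, fun h => ?_⟩
  · rw [← pure_sup_nhdsNE, tendsto_sup]
    refine ⟨tendsto_pure_left.2 fun s hs => by simpa using mem_of_mem_nhds hs, hc.congr' ?_⟩
    filter_upwards [self_mem_nhdsWithin] with h hh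
    exact (if_neg hh).symm
  · by_cases hh : h = 0
    · simp [hh]
    · simp [hh, smul_smul]

lemma of_slope {c q : ℝ → E} {v : E} {t : ℝ} (hq : Tendsto q (𝓝[≠] 0) (𝓝 v))
    (h : ∀ᶠ s in 𝓝[≠] 0, c (t + s) = c t + s • q s) : HasCurveDeriv c v t := by
  refine hq.congr' ?_
  filter_upwards [h, self_mem_nhdsWithin] with s hs hs'
  rw [hs, add_sub_cancel_left, smul_smul, inv_mul_cancel₀ hs', one_smul]

lemma tendsto {c : ℝ → E} {v : E} {t : ℝ} (hc : HasCurveDeriv c v t) :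
    Tendsto (fun h => c (t + h)) (𝓝 0) (𝓝 (c t)) := by
  obtain ⟨q, hq, h⟩ := hc.exists_slope
  have : Tendsto (fun h => c t + h • q h) (𝓝 0) (𝓝 (c t + (0 : ℝ) • v)) :=
    (tendsto_id.smul hq).const_add _
  simpa [h] using this

lemma continuousAt {c : ℝ → E} {v : E} {t : ℝ} (hc : HasCurveDeriv c v t) : ContinuousAt c t := by
  have h1 : Tendsto (fun s : ℝ => s - t) (𝓝 t) (𝓝 0) := by
    have : Tendsto (fun s : ℝ => s - t) (𝓝 t) (𝓝 (t - t)) := tendsto_id.sub_const t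
    rwa [sub_self] at this
  simpa [ContinuousAt, Function.comp_def] using hc.tendsto.comp h1

lemma smul {φ : ℝ → ℝ} {c : ℝ → E} {a : ℝ} {v : E} {t : ℝ} (hφ : HasDerivAt φ a t)
    (hc : HasCurveDeriv c v t) : HasCurveDeriv (fun s => φ s • c s) (a • c t + φ t • v) t := by
  have h1 := Tendsto.smul (hasCurveDeriv_iff_hasDerivAt.2 hφ)
    (hc.tendsto.mono_left nhdsWithin_le_nhds)
  refine (h1.add (Tendsto.const_smul hc (φ t))).congr fun h => ?_
  simp only [smul_eq_mul, sub_smul, smul_sub, smul_smul, mul_sub, mul_comm (φ t)]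
  abel

/-- Multiplying slopes extended by the derivative avoids dividing by the increment of `φ`, which may
vanish. -/
lemma comp {c : ℝ → E} {v : E} {φ : ℝ → ℝ} {a t : ℝ} (hc : HasCurveDeriv c v (φ t))
    (hφ : HasDerivAt φ a t) : HasCurveDeriv (fun s => c (φ s)) (a • v) t := by
  obtain ⟨q, hq, h⟩ := hc.exists_slope
  obtain ⟨r, hr, h'⟩ := (hasCurveDeriv_iff_hasDerivAt.2 hφ).exists_slope
  have h0 : Tendsto (fun s => s • r s) (𝓝 0) (𝓝 0) := by
    simpa using (tendsto_id (α := ℝ)).smul hr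
  refine of_slope (q := fun s => r s • q (s • r s))
    ((hr.smul (hq.comp h0)).mono_left nhdsWithin_le_nhds) (Eventually.of_forall fun s => ?_)
  rw [h' s, h, smul_smul, smul_eq_mul]

end HasCurveDeriv

lemma hasCurveDeriv_line [IsTopologicalAddGroup E] [ContinuousSMul ℝ E] (x v : E) (t : ℝ) :
    HasCurveDeriv (fun s : ℝ => x + s • v) v t := by
  simpa using (HasCurveDeriv.const x t).add (HasCurveDeriv.smul_const (hasDerivAt_id t) v)

/-- `c` is `n` times differentiable. -/
def CurveDiff : ℕ → (ℝ → E) → Prop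
  | 0, _ => True
  | n + 1, c => ∃ c' : ℝ → E, (∀ t, HasCurveDeriv c (c' t) t) ∧ CurveDiff n c'

lemma CurveDiff.of_succ : ∀ {n : ℕ} {c : ℝ → E}, CurveDiff (n + 1) c → CurveDiff n c
  | 0, _, _ => trivial
  | _ + 1, _, ⟨c', h, h'⟩ => ⟨c', h, h'.of_succ⟩

/-- Derivatives are unique in a Hausdorff space, so the derivatives of the local models glue to a
derivative of `c`, which is again locally modelled. -/
lemma curveDiff_of_local [T2Space E] (n : ℕ) {c : ℝ → E} (h : ∀ t, ∃ d, CurveDiff n d ∧ d =ᶠ[𝓝 t] c) :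
    CurveDiff n c := by
  induction n generalizing c with
  | zero => trivial
  | succ n ih =>
    choose d hd hdc using h
    choose d' hd' hn using hd
    have key : ∀ t, HasCurveDeriv c (d' t t) t := fun t => (hd' t t).congr (hdc t)
    refine ⟨fun t => d' t t, key, ih fun t => ⟨d' t, hn t, ?_⟩⟩
    filter_upwards [eventually_eventually_nhds.2 (hdc t)] with s hs
    exact ((hd' t s).congr hs).unique (key s)

lemma SmoothCurve.curveDiff {c : ℝ → E} (hc : SmoothCurve c) (n : ℕ) : CurveDiff n c := by
  obtain ⟨d, rfl, hd⟩ := hc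
  suffices ∀ n k, CurveDiff n (d k) from this n 0
  intro n
  induction n with
  | zero => exact fun _ => trivial
  | succ n ih => exact fun k => ⟨d (k + 1), hd k, ih _⟩

lemma smoothCurve_of_curveDiff [T2Space E] {c : ℝ → E} (hc : ∀ n, CurveDiff n c) :
    SmoothCurve c := by
  -- The derivatives witnessing different orders agree by uniqueness, so differentiation is an
  -- operator on infinitely differentiable curves; iterating it gives a single sequence.
  have key : ∀ c : {c : ℝ → E // ∀ n, CurveDiff n c}, ∃ c' : {c : ℝ → E // ∀ n, CurveDiff n c},
      ∀ t, HasCurveDeriv c.1 (c'.1 t) t := by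
    rintro ⟨c, hc⟩
    obtain ⟨c', h, -⟩ := hc 1
    refine ⟨⟨c', fun n => ?_⟩, h⟩
    obtain ⟨c'', h', h''⟩ := hc (n + 1)
    rwa [show c' = c'' from funext fun t => (h t).unique (h' t)]
  choose D hD using key
  exact ⟨fun n => (D^[n] ⟨c, hc⟩).1, rfl, fun n t => by
    
    simpa only [Function.iterate_succ_apply', HasCurveDeriv] using hD _ t⟩

lemma SmoothCurve.exists_deriv {c : ℝ → E} (hc : SmoothCurve c) :
    ∃ c' : ℝ → E, (∀ t, HasCurveDeriv c (c' t) t) ∧ SmoothCurve c' := by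
  obtain ⟨d, rfl, hd⟩ := hc
  exact ⟨d 1, hd 0, fun n => d (n + 1), rfl, fun n => hd (n + 1)⟩

lemma SmoothCurve.map {c : ℝ → E} (hc : SmoothCurve c) (L : E →L[ℝ] F) :
    SmoothCurve (fun t => L (c t)) := by
  obtain ⟨d, rfl, hd⟩ := hc
  exact ⟨fun n t => L (d n t), rfl, fun n t => HasCurveDeriv.map (hd n t) L⟩

lemma SmoothCurve.prodMk {c : ℝ → E} {d : ℝ → F} (hc : SmoothCurve c) (hd : SmoothCurve d) :
    SmoothCurve (fun t => (c t, d t)) := by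
  obtain ⟨c, rfl, hc⟩ := hc
  obtain ⟨d, rfl, hd⟩ := hd
  exact ⟨fun n t => (c n t, d n t), rfl, fun n t => HasCurveDeriv.prodMk (hc n t) (hd n t)⟩

lemma curveDiff_of_contDiff {φ : ℝ → ℝ} (hφ : ContDiff ℝ (⊤ : ℕ∞) φ) (n : ℕ) : CurveDiff n φ := by
  induction n generalizing φ with
  | zero => trivial
  | succ n ih =>
    rw [contDiff_infty_iff_deriv] at hφ
    exact ⟨deriv φ, fun t => hasCurveDeriv_iff_hasDerivAt.2 (hφ.1 t).hasDerivAt, ih hφ.2⟩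

lemma smoothCurve_of_contDiff {φ : ℝ → ℝ} (hφ : ContDiff ℝ (⊤ : ℕ∞) φ) : SmoothCurve φ :=
  smoothCurve_of_curveDiff (curveDiff_of_contDiff hφ)

section

variable [IsTopologicalAddGroup E] [ContinuousSMul ℝ E]

lemma smoothCurve_const (v : E) : SmoothCurve (fun _ : ℝ => v) :=
  ⟨fun n _ => if n = 0 then v else 0, by simp, fun n t => HasCurveDeriv.const _ t⟩

lemma SmoothCurve.continuous {c : ℝ → E} (hc : SmoothCurve c) : Continuous c := by
  obtain ⟨c', h, -⟩ := hc.exists_deriv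
  exact continuous_iff_continuousAt.2 fun t => (h t).continuousAt

lemma SmoothCurve.add {c d : ℝ → E} (hc : SmoothCurve c) (hd : SmoothCurve d) :
    SmoothCurve (fun t => c t + d t) := by
  obtain ⟨c, rfl, hc⟩ := hc
  obtain ⟨d, rfl, hd⟩ := hd
  exact ⟨fun n t => c n t + d n t, rfl, fun n t => HasCurveDeriv.add (hc n t) (hd n t)⟩

lemma CurveDiff.add {n : ℕ} {c d : ℝ → E} (hc : CurveDiff n c) (hd : CurveDiff n d) :
    CurveDiff n (fun t => c t + d t) := by
  induction n generalizing c d with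
  | zero => trivial
  | succ n ih =>
    obtain ⟨c', h, hc'⟩ := hc
    obtain ⟨d', h', hd'⟩ := hd
    exact ⟨_, fun t => (h t).add (h' t), ih hc' hd'⟩

lemma CurveDiff.smul {n : ℕ} {φ : ℝ → ℝ} {c : ℝ → E} (hφ : CurveDiff n φ) (hc : CurveDiff n c) :
    CurveDiff n (fun t => φ t • c t) := by
  induction n generalizing φ c with
  | zero => trivial
  | succ n ih =>
    have hφ0 := hφ.of_succ
    have hc0 := hc.of_succ
    obtain ⟨c', h, hc'⟩ := hc
    obtain ⟨φ', h', hφ'⟩ := hφ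
    exact ⟨_, fun t => HasCurveDeriv.smul (hasCurveDeriv_iff_hasDerivAt.1 (h' t)) (h t),
      (ih hφ' hc0).add (ih hφ0 hc')⟩

lemma CurveDiff.comp {n : ℕ} {φ : ℝ → ℝ} {c : ℝ → E} (hc : CurveDiff n c) (hφ : ContDiff ℝ (⊤ : ℕ∞) φ) :
    CurveDiff n (fun t => c (φ t)) := by
  induction n generalizing c with
  | zero => trivial
  | succ n ih =>
    obtain ⟨c', h, hc'⟩ := hc
    rw [contDiff_infty_iff_deriv] at hφ
    exact ⟨_, fun t => (h (φ t)).comp (hφ.1 t).hasDerivAt,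
      (curveDiff_of_contDiff hφ.2 n).smul (ih hc')⟩

variable [T2Space E]

lemma SmoothCurve.smul {φ : ℝ → ℝ} {c : ℝ → E} (hφ : SmoothCurve φ) (hc : SmoothCurve c) :
    SmoothCurve (fun t => φ t • c t) :=
  smoothCurve_of_curveDiff fun n => (hφ.curveDiff n).smul (hc.curveDiff n)

lemma SmoothCurve.comp_contDiff {φ : ℝ → ℝ} {c : ℝ → E} (hc : SmoothCurve c)
    (hφ : ContDiff ℝ (⊤ : ℕ∞) φ) : SmoothCurve (fun t => c (φ t)) :=
  smoothCurve_of_curveDiff fun n => (hc.curveDiff n).comp hφ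

end

/-! ### Germs of smooth curves and of smooth maps -/

/-- Near `t`, the curve `c` agrees with a smooth curve. -/
def SmoothCurveAt (c : ℝ → E) (t : ℝ) : Prop := ∃ d : ℝ → E, SmoothCurve d ∧ d =ᶠ[𝓝 t] c

lemma SmoothCurve.at {c : ℝ → E} (hc : SmoothCurve c) (t : ℝ) : SmoothCurveAt c t :=
  ⟨c, hc, EventuallyEq.rfl⟩

lemma SmoothCurveAt.congr {c d : ℝ → E} {t : ℝ} (hc : SmoothCurveAt c t) (h : c =ᶠ[𝓝 t] d) :
    SmoothCurveAt d t := by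
  obtain ⟨e, he, hec⟩ := hc
  exact ⟨e, he, hec.trans h⟩

lemma SmoothCurveAt.exists_deriv {c : ℝ → E} {t : ℝ} (hc : SmoothCurveAt c t) :
    ∃ v, HasCurveDeriv c v t := by
  obtain ⟨d, hd, h⟩ := hc
  obtain ⟨d', hd', -⟩ := hd.exists_deriv
  exact ⟨d' t, (hd' t).congr h⟩

lemma SmoothCurveAt.prodMk {c : ℝ → E} {d : ℝ → F} {t : ℝ} (hc : SmoothCurveAt c t)
    (hd : SmoothCurveAt d t) : SmoothCurveAt (fun t => (c t, d t)) t := by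
  obtain ⟨c', hc', h⟩ := hc
  obtain ⟨d', hd', h'⟩ := hd
  refine ⟨_, hc'.prodMk hd', ?_⟩
  filter_upwards [h, h'] with s hs hs'
  rw [hs, hs']

lemma SmoothCurveAt.map {c : ℝ → E} {t : ℝ} (hc : SmoothCurveAt c t) (L : E →L[ℝ] F) :
    SmoothCurveAt (fun t => L (c t)) t := by
  obtain ⟨c', hc', h⟩ := hc
  refine ⟨_, hc'.map L, ?_⟩
  filter_upwards [h] with s hs
  rw [hs]

lemma smoothCurve_of_at [T2Space E] {c : ℝ → E} (h : ∀ t, SmoothCurveAt c t) : SmoothCurve c := by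
  refine smoothCurve_of_curveDiff fun n => curveDiff_of_local n fun t => ?_
  obtain ⟨d, hd, hdc⟩ := h t
  exact ⟨d, hd.curveDiff n, hdc⟩

/-- A smooth retraction of the line into a neighbourhood of `t`, equal to the identity near `t`. -/
lemma exists_contDiff_retract {V : Set ℝ} {t : ℝ} (hV : V ∈ 𝓝 t) :
    ∃ φ : ℝ → ℝ, ContDiff ℝ (⊤ : ℕ∞) φ ∧ (∀ s, φ s ∈ V) ∧ ∀ᶠ s in 𝓝 t, φ s = s := by
  obtain ⟨r, hr, hrV⟩ := Metric.mem_nhds_iff.1 hV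
  let b : ContDiffBump t := ⟨r / 2, r, by positivity, by linarith⟩
  refine ⟨fun s => t + b s * (s - t), ?_, fun s => hrV ?_, ?_⟩
  · exact contDiff_const.add (b.contDiff.mul (contDiff_id.sub contDiff_const))
  · by_cases hs : s ∈ Metric.ball t r
    · rw [Metric.mem_ball, Real.dist_eq, add_sub_cancel_left, abs_mul, abs_of_nonneg b.nonneg]
      rw [Metric.mem_ball, Real.dist_eq] at hs
      exact (mul_le_of_le_one_left (abs_nonneg _) b.le_one).trans_lt hs
    · have : b s = 0 := by
        by_contra h
        have : s ∈ Function.support b := h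
        rw [b.support_eq] at this
        exact hs this
      simpa [this] using hr
  · filter_upwards [b.eventuallyEq_one] with s hs
    rw [hs]; simp

section

variable [IsTopologicalAddGroup E] [ContinuousSMul ℝ E]

lemma SmoothCurveAt.continuousAt {c : ℝ → E} {t : ℝ} (hc : SmoothCurveAt c t) :
    ContinuousAt c t := by
  obtain ⟨v, hv⟩ := hc.exists_deriv
  exact hv.continuousAt

lemma SmoothCurveAt.add {c d : ℝ → E} {t : ℝ} (hc : SmoothCurveAt c t) (hd : SmoothCurveAt d t) :
    SmoothCurveAt (fun t => c t + d t) t := by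
  obtain ⟨c', hc', h⟩ := hc
  obtain ⟨d', hd', h'⟩ := hd
  refine ⟨_, hc'.add hd', ?_⟩
  filter_upwards [h, h'] with s hs hs'
  rw [hs, hs']

variable [T2Space E]

lemma SmoothCurveAt.smul {φ : ℝ → ℝ} {c : ℝ → E} {t : ℝ} (hφ : SmoothCurveAt φ t)
    (hc : SmoothCurveAt c t) : SmoothCurveAt (fun t => φ t • c t) t := by
  obtain ⟨c', hc', h⟩ := hφ
  obtain ⟨d', hd', h'⟩ := hc
  refine ⟨_, hc'.smul hd', ?_⟩
  filter_upwards [h, h'] with s hs hs'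
  rw [hs, hs']

/-- A smooth curve can be reparametrized into a neighbourhood of a given parameter. -/
lemma SmoothCurveAt.exists_smoothCurve {c : ℝ → E} {t : ℝ} (hc : SmoothCurveAt c t)
    {V : Set ℝ} (hV : V ∈ 𝓝 t) : ∃ d : ℝ → E, SmoothCurve d ∧ d =ᶠ[𝓝 t] c ∧ ∀ s, d s ∈ c '' V := by
  obtain ⟨d, hd, h⟩ := hc
  obtain ⟨φ, hφ, hφV, hφt⟩ := exists_contDiff_retract (inter_mem hV h)
  refine ⟨fun s => d (φ s), hd.comp_contDiff hφ, ?_, fun s => ⟨φ s, (hφV s).1, (hφV s).2.symm⟩⟩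
  filter_upwards [hφt, h] with s hs hs'
  rw [hs, hs']

lemma smoothCurve_line (x v : E) : SmoothCurve (fun t : ℝ => x + t • v) :=
  (smoothCurve_const x).add ((smoothCurve_of_contDiff contDiff_id).smul (smoothCurve_const v))

lemma CInftyOpen.preimage_mem_nhds {U : Set E} (hU : CInftyOpen U) {c : ℝ → E} {t : ℝ}
    (hc : SmoothCurveAt c t) (ht : c t ∈ U) : ∀ᶠ s in 𝓝 t, c s ∈ U := by
  obtain ⟨d, hd, h⟩ := hc
  have h1 : ∀ᶠ s in 𝓝 t, d s ∈ U := (hU d hd).mem_nhds (by simpa [h.eq_of_nhds] using ht)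
  filter_upwards [h, h1] with s hs hs'
  rwa [← hs]

end

lemma CInftyOpen.inter {U V : Set E} (hU : CInftyOpen U) (hV : CInftyOpen V) :
    CInftyOpen (U ∩ V) := fun c hc => (hU c hc).inter (hV c hc)

/-- `f` maps germs of smooth curves through `x` to germs of smooth curves. -/
def CSmoothAt (f : E → F) (x : E) : Prop :=
  ∀ (c : ℝ → E) (t : ℝ), SmoothCurveAt c t → c t = x → SmoothCurveAt (fun s => f (c s)) t

lemma CSmoothAt.comp {G : Type*} [AddCommGroup G] [Module ℝ G] [TopologicalSpace G]
    {g : F → G} {f : E → F} {x : E} (hg : CSmoothAt g (f x)) (hf : CSmoothAt f x) :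
    CSmoothAt (fun y => g (f y)) x :=
  fun c t hc ht => hg _ t (hf c t hc ht) (by rw [ht])

lemma CSmoothAt.prodMk {G : Type*} [AddCommGroup G] [Module ℝ G] [TopologicalSpace G]
    {g : E → G} {f : E → F} {x : E} (hg : CSmoothAt g x) (hf : CSmoothAt f x) :
    CSmoothAt (fun y => (g y, f y)) x :=
  fun c t hc ht => (hg c t hc ht).prodMk (hf c t hc ht)

lemma cSmoothAt_id (x : E) : CSmoothAt (fun y : E => y) x := fun _ _ hc _ => hc

lemma CSmoothAt.map {G : Type*} [AddCommGroup G] [Module ℝ G] [TopologicalSpace G]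
    {f : E → F} {x : E} (hf : CSmoothAt f x) (L : F →L[ℝ] G) : CSmoothAt (fun y => L (f y)) x :=
  fun c t hc ht => (hf c t hc ht).map L

lemma cSmoothAt_const [IsTopologicalAddGroup F] [ContinuousSMul ℝ F] (v : F) (x : E) :
    CSmoothAt (fun _ : E => v) x := fun _ t _ _ => (smoothCurve_const v).at t

lemma CSmoothAt.add [IsTopologicalAddGroup F] [ContinuousSMul ℝ F] {f g : E → F} {x : E}
    (hf : CSmoothAt f x) (hg : CSmoothAt g x) : CSmoothAt (fun y => f y + g y) x :=
  fun c t hc ht => (hf c t hc ht).add (hg c t hc ht)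

lemma CSmoothAt.sum [IsTopologicalAddGroup F] [ContinuousSMul ℝ F] {ι : Type*} (s : Finset ι)
    {f : ι → E → F} {x : E} (hf : ∀ i, CSmoothAt (f i) x) :
    CSmoothAt (fun y => ∑ i ∈ s, f i y) x := by
  classical
  induction s using Finset.induction_on with
  | empty => simpa using cSmoothAt_const 0 x
  | insert i s hi ih => simpa [Finset.sum_insert hi] using (hf i).add ih

lemma CSmoothAt.smul [IsTopologicalAddGroup F] [ContinuousSMul ℝ F] [T2Space F] {φ : E → ℝ}
    {f : E → F} {x : E} (hφ : CSmoothAt φ x) (hf : CSmoothAt f x) :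
    CSmoothAt (fun y => φ y • f y) x :=
  fun c t hc ht => (hφ c t hc ht).smul (hf c t hc ht)

section

variable [IsTopologicalAddGroup E] [ContinuousSMul ℝ E] [T2Space E]

lemma CSmoothAt.congr {f g : E → F} {x : E} (hf : CSmoothAt f x) {U : Set E} (hU : CInftyOpen U)
    (hx : x ∈ U) (h : ∀ y ∈ U, f y = g y) : CSmoothAt g x := fun c t hc ht =>
  (hf c t hc ht).congr (by
    filter_upwards [hU.preimage_mem_nhds hc (by rwa [ht])] with s hs using h _ hs)

/-- A germ at a point of `U` is represented, after a reparametrization, by a curve that stays in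
`U`, where the hypothesis applies. -/
lemma CSmoothOn.cSmoothAt {U : Set E} (hU : CInftyOpen U) {f : E → F} (hf : CSmoothOn U f) {x : E}
    (hx : x ∈ U) : CSmoothAt f x := by
  intro c t hc ht
  obtain ⟨d, hd, hdc, hdU⟩ := hc.exists_smoothCurve (hU.preimage_mem_nhds hc (by rwa [ht]))
  refine (hf d hd fun s => ?_).at t |>.congr ?_
  · obtain ⟨r, hr, h⟩ := hdU s
    rw [← h]; exact hr
  · filter_upwards [hdc] with s hs
    simp [hs]

lemma cSmoothOn_of_cSmoothAt [T2Space F] {U : Set E} {f : E → F} (hf : ∀ x ∈ U, CSmoothAt f x) :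
    CSmoothOn U f := fun c hc hcU =>
  smoothCurve_of_at fun t => hf _ (hcU t) c t (hc.at t) rfl

end

/-- The directional derivative of a map that is smooth at `x`. -/
lemma CSmoothAt.hasCurveDeriv_line [IsTopologicalAddGroup E] [ContinuousSMul ℝ E] [T2Space E]
    [T2Space F] {f : E → F} {x : E} (hf : CSmoothAt f x) (v : E) :
    HasCurveDeriv (fun t : ℝ => f (x + t • v)) (cdiff f x v) 0 := by
  have h1 := hf _ 0 ((smoothCurve_line x v).at 0) (by simp)
  obtain ⟨w, hw⟩ := h1.exists_deriv
  have h2 : Tendsto (fun t : ℝ => t⁻¹ • (f (x + t • v) - f x)) (𝓝[≠] 0) (𝓝 w) := by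
    simpa [HasCurveDeriv] using hw
  rwa [cdiff, h2.limUnder_eq]

lemma HasCurveDeriv.cdiff_eq [T2Space F] {f : E → F} {x v : E} {w : F}
    (h : HasCurveDeriv (fun t : ℝ => f (x + t • v)) w 0) : cdiff f x v = w := by
  have h2 : Tendsto (fun t : ℝ => t⁻¹ • (f (x + t • v) - f x)) (𝓝[≠] 0) (𝓝 w) := by
    simpa [HasCurveDeriv] using h
  rw [cdiff, h2.limUnder_eq]

end CurveCalculus

/-! ### Second order Taylor estimates and bounded bilinear forms -/

section Taylor

/-- The mean value inequality, applied first to `φ₁` and then to `φ` minus its tangent. The lost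
factor `1 / 2` is harmless. -/
lemma abs_taylor_le {φ φ₁ φ₂ : ℝ → ℝ} (h₁ : ∀ t, HasDerivAt φ (φ₁ t) t)
    (h₂ : ∀ t, HasDerivAt φ₁ (φ₂ t) t) {t r C : ℝ} (hC : ∀ s, |s - t| ≤ r → |φ₂ s| ≤ C)
    {h : ℝ} (hh : |h| ≤ r) : |φ (t + h) - φ t - h * φ₁ t| ≤ C * h ^ 2 := by
  have hC0 : 0 ≤ C := (abs_nonneg _).trans (hC t (by simpa using (abs_nonneg h).trans hh))
  have step : ∀ s, |s - t| ≤ r → |φ₁ s - φ₁ t| ≤ C * |s - t| := by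
    intro s hs
    refine (convex_Icc (t - r) (t + r)).norm_image_sub_le_of_norm_hasDerivWithin_le
      (f := φ₁) (f' := φ₂) (fun x _ => (h₂ x).hasDerivWithinAt) (fun x hx => hC x ?_) ?_ ?_
    · rw [abs_le]; constructor <;> linarith [hx.1, hx.2]
    · constructor <;> linarith [abs_nonneg (s - t)]
    · rw [abs_le] at hs; constructor <;> linarith [hs.1, hs.2]
  have hf : ∀ s, HasDerivAt (fun s => φ s - (s - t) * φ₁ t) (φ₁ s - φ₁ t) s := fun s => by
    simpa using (h₁ s).fun_sub (((hasDerivAt_id s).sub_const t).mul_const (φ₁ t))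
  have := (convex_Icc (t - |h|) (t + |h|)).norm_image_sub_le_of_norm_hasDerivWithin_le
    (C := C * |h|) (x := t) (y := t + h)
    (fun x _ => (hf x).hasDerivWithinAt) (fun x hx => ?_) ?_ ?_
  · simp only [add_sub_cancel_left, sub_self, zero_mul, sub_zero, Real.norm_eq_abs] at this
    calc _ = |φ (t + h) - h * φ₁ t - φ t| := by congr 1; ring
      _ ≤ C * |h| * |h| := this
      _ = C * h ^ 2 := by rw [mul_assoc, abs_mul_abs_self, sq]
  · have hx' : |x - t| ≤ |h| := by rw [abs_le]; constructor <;> linarith [hx.1, hx.2]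
    exact (step x (hx'.trans hh)).trans (by gcongr)
  · constructor <;> linarith [abs_nonneg h]
  · constructor <;> linarith [neg_abs_le h, le_abs_self h]

variable {E : Type*} [AddCommGroup E] [Module ℝ E] [TopologicalSpace E]
  [IsTopologicalAddGroup E] [ContinuousSMul ℝ E] [LocallyConvexSpace ℝ E]
variable {F : Type*} [AddCommGroup F] [Module ℝ F] [TopologicalSpace F]
  [IsTopologicalAddGroup F] [ContinuousSMul ℝ F] [LocallyConvexSpace ℝ F]

lemma isVonNBounded_iff_continuous_seminorm {s : Set E} :
    Bornology.IsVonNBounded ℝ s ↔ ∀ p : Seminorm ℝ E, Continuous p → ∃ C, ∀ x ∈ s, p x ≤ C := by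
  rw [(PolynormableSpace.withSeminorms ℝ E).isVonNBounded_iff_seminorm_bounded]
  constructor
  · intro h p hp
    obtain ⟨r, -, hr⟩ := h ⟨p, hp⟩
    exact ⟨r, fun x hx => (hr x hx).le⟩
  · rintro h ⟨p, hp⟩
    obtain ⟨C, hC⟩ := h p hp
    exact ⟨|C| + 1, by positivity, fun x hx => by
      have := (hC x hx).trans (le_abs_self C)
      change p x < _
      linarith⟩

lemma tendsto_iff_continuous_seminorm {α : Type*} {l : Filter α} {u : α → E} {y : E} :
    Tendsto u l (𝓝 y) ↔
      ∀ p : Seminorm ℝ E, Continuous p → ∀ ε : ℝ, 0 < ε → ∀ᶠ x in l, p (u x - y) < ε := by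
  rw [(PolynormableSpace.withSeminorms ℝ E).tendsto_nhds]
  exact ⟨fun h p hp => h ⟨p, hp⟩, fun h p => h p.1 p.2⟩

/-- Hahn–Banach on the line through `z`. It turns seminorm estimates for curves in `E` into
estimates for real functions. -/
lemma exists_dual_of_seminorm {p : Seminorm ℝ E} (hp : Continuous p) (z : E) :
    ∃ l : E →L[ℝ] ℝ, l z = p z ∧ ∀ x, |l x| ≤ p x := by
  by_cases hz : z = 0
  · exact ⟨0, by simp [hz], fun x => by simp⟩
  let e := LinearEquiv.toSpanNonzeroSingleton ℝ E z hz
  obtain ⟨l, hl, hlp⟩ := Module.Dual.exists_continuous_extension_of_le_seminorm_real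
    (Submodule.span ℝ {z}) (p z • e.symm.toLinearMap) hp (fun x => by
      obtain ⟨a, rfl⟩ := e.surjective x
      have : (e a : E) = a • z := rfl
      simp only [LinearMap.smul_apply, LinearEquiv.coe_coe, LinearEquiv.symm_apply_apply,
        smul_eq_mul, this, map_smul_eq_mul, Real.norm_eq_abs]
      rw [mul_comm]
      exact mul_le_mul_of_nonneg_right (le_abs_self a) (apply_nonneg p z))
  refine ⟨l, ?_, hlp⟩
  have h1 := hl (e 1)
  have : (e 1 : E) = z := one_smul ℝ z
  simpa [this] using h1

lemma SmoothCurve.seminorm_taylor_le {c c' : ℝ → E} (hc : SmoothCurve c)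
    (hc' : ∀ t, HasCurveDeriv c (c' t) t) [T2Space E] {p : Seminorm ℝ E} (hp : Continuous p)
    (t : ℝ) : ∃ C, ∀ s h, |s - t| ≤ 1 → |h| ≤ 1 → p (c (s + h) - c s - h • c' s) ≤ C * h ^ 2 := by
  obtain ⟨c₁, h1, hs1⟩ := hc.exists_deriv
  obtain rfl : c' = c₁ := funext fun t => (hc' t).unique (h1 t)
  obtain ⟨c₂, h2, hs2⟩ := hs1.exists_deriv
  -- The base point moves by at most 1 from `t`, and the increment by at most 1 more.
  obtain ⟨C, hC⟩ := (isCompact_Icc (a := t - 2) (b := t + 2)).bddAbove_image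
    (hp.comp hs2.continuous).continuousOn
  refine ⟨C, fun s h hs hh => ?_⟩
  obtain ⟨l, hl, hlp⟩ := exists_dual_of_seminorm hp (c (s + h) - c s - h • c' s)
  rw [← hl]
  refine (le_abs_self _).trans ?_
  simp only [map_sub, map_smul, smul_eq_mul]
  refine abs_taylor_le (φ := fun t => l (c t)) (φ₁ := fun t => l (c' t)) (φ₂ := fun t => l (c₂ t))
    (r := 1) (fun t => hasCurveDeriv_iff_hasDerivAt.1 ((h1 t).map l))
    (fun t => hasCurveDeriv_iff_hasDerivAt.1 ((h2 t).map l)) (fun x hx => ?_) hh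
  refine (hlp _).trans (hC ⟨x, ?_, rfl⟩)
  rw [abs_le] at hs hx
  constructor <;> linarith [hs.1, hs.2, hx.1, hx.2]

/-- The second order remainder of a smooth curve is bounded. -/
lemma SmoothCurveAt.taylor_bounded [T2Space E] {c : ℝ → E} {v : E} {t : ℝ}
    (hc : SmoothCurveAt c t) (hv : HasCurveDeriv c v t) :
    ∃ A : Set E, Bornology.IsVonNBounded ℝ A ∧
      ∀ᶠ h in 𝓝 (0 : ℝ), ∃ ρ ∈ A, c (t + h) = c t + h • v + h ^ 2 • ρ := by
  obtain ⟨d, hd, hdc⟩ := hc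
  obtain ⟨d', hd', -⟩ := hd.exists_deriv
  obtain rfl : d' t = v := (hd' t).unique (hv.congr hdc.symm)
  -- At `h = 0` the inverse is zero by convention, so the quotient is the harmless element `0`.
  refine ⟨(fun h : ℝ => (h ^ 2)⁻¹ • (d (t + h) - d t - h • d' t)) '' {h | |h| ≤ 1}, ?_, ?_⟩
  · rw [isVonNBounded_iff_continuous_seminorm]
    intro p hp
    obtain ⟨C, hC⟩ := hd.seminorm_taylor_le hd' hp t
    refine ⟨|C|, ?_⟩
    rintro _ ⟨h, hh, rfl⟩
    have := hC t h (by simp) hh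
    rw [map_smul_eq_mul, norm_inv, norm_pow, Real.norm_eq_abs, sq_abs]
    by_cases h0 : h = 0
    · simp [h0]
    · have h2 : 0 < h ^ 2 := by positivity
      rw [inv_mul_le_iff₀ h2]
      nlinarith [le_abs_self C]
  · have h1 : Tendsto (fun h : ℝ => t + h) (𝓝 0) (𝓝 t) := by
      have : Tendsto (fun h : ℝ => t + h) (𝓝 0) (𝓝 (t + 0)) := tendsto_id.const_add t
      rwa [add_zero] at this
    have h2 : ∀ᶠ h in 𝓝 (0 : ℝ), |h| < 1 :=
      (continuous_abs.tendsto' (0 : ℝ) 0 abs_zero).eventually (gt_mem_nhds one_pos)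
    filter_upwards [h1.eventually hdc, h2] with h hh hh1
    refine ⟨_, ⟨h, hh1.le, rfl⟩, ?_⟩
    rw [← hh, ← hdc.eq_of_nhds]
    by_cases h0 : h = 0
    · simp [h0]
    · rw [smul_smul, mul_inv_cancel₀ (pow_ne_zero 2 h0), one_smul]; abel

/-- The Leibniz rule for a bounded bilinear form. -/
lemma HasCurveDeriv.hasDerivAt_bilin [T2Space E] [T2Space F] {B : F →ₗ[ℝ] E →ₗ[ℝ] ℝ}
    (hB : ∀ (A : Set F) (A' : Set E), Bornology.IsVonNBounded ℝ A →
      Bornology.IsVonNBounded ℝ A' → ∃ C : ℝ, ∀ ξ ∈ A, ∀ v ∈ A', |B ξ v| ≤ C)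
    {ξ : ℝ → F} {w : ℝ → E} {ξ' : F} {w' : E} {t : ℝ} (hξs : SmoothCurveAt ξ t)
    (hws : SmoothCurveAt w t) (hξ : HasCurveDeriv ξ ξ' t) (hw : HasCurveDeriv w w' t) :
    HasDerivAt (fun s => B (ξ s) (w s)) (B ξ' (w t) + B (ξ t) w') t := by
  obtain ⟨A, hA, hAξ⟩ := hξs.taylor_bounded hξ
  obtain ⟨A', hA', hAw⟩ := hws.taylor_bounded hw
  -- Adding the values and the derivatives to the remainder sets makes one constant bound every
  -- pairing in the expansion.
  obtain ⟨C, hC⟩ := hB (A ∪ {ξ t, ξ'}) (A' ∪ {w t, w'})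
    (hA.union ((Set.toFinite _).isVonNBounded)) (hA'.union ((Set.toFinite _).isVonNBounded))
  have hC0 : 0 ≤ C := (abs_nonneg _).trans (hC (ξ t) (by simp) (w t) (by simp))
  rw [hasDerivAt_iff_tendsto_slope_zero, tendsto_iff_norm_sub_tendsto_zero]
  -- After the derivative is removed, the error is `h` times six pairings, each at most `C` once
  -- `|h| < 1`.
  have hlim : Tendsto (fun h : ℝ => |h| * (6 * C)) (𝓝[≠] 0) (𝓝 0) := by
    have : Tendsto (fun h : ℝ => |h| * (6 * C)) (𝓝 0) (𝓝 (|0| * (6 * C))) :=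
      (continuous_abs.mul continuous_const).tendsto 0
    rw [abs_zero, zero_mul] at this
    exact this.mono_left nhdsWithin_le_nhds
  have h2 : ∀ᶠ h in 𝓝 (0 : ℝ), |h| < 1 :=
    (continuous_abs.tendsto' (0 : ℝ) 0 abs_zero).eventually (gt_mem_nhds one_pos)
  refine squeeze_zero' (Eventually.of_forall fun _ => norm_nonneg _) ?_ hlim
  filter_upwards [nhdsWithin_le_nhds hAξ, nhdsWithin_le_nhds hAw, nhdsWithin_le_nhds h2,
    self_mem_nhdsWithin] with h ⟨ρ, hρ, h3⟩ ⟨σ, hσ, h4⟩ h1 h0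
  have h0 : h ≠ 0 := h0
  have key : h⁻¹ • (B (ξ (t + h)) (w (t + h)) - B (ξ t) (w t)) - (B ξ' (w t) + B (ξ t) w')
      = h * (B ξ' w' + B (ξ t) σ + B ρ (w t) + h * B ξ' σ + h * B ρ w' + h * h * B ρ σ) := by
    rw [h3, h4]
    simp only [map_add, map_smul, LinearMap.add_apply, LinearMap.smul_apply, smul_eq_mul]
    field_simp
    ring
  rw [key, norm_mul, Real.norm_eq_abs, Real.norm_eq_abs]
  refine mul_le_mul_of_nonneg_left ?_ (abs_nonneg h)
  have bd : ∀ a b : ℝ, |a| ≤ 1 → |b| ≤ C → |a * b| ≤ C := fun a b ha hb => by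
    rw [abs_mul]; exact (mul_le_of_le_one_left (abs_nonneg b) ha).trans hb
  have e1 := hC ξ' (by simp) w' (by simp)
  have e2 := hC (ξ t) (by simp) σ (by simp [hσ])
  have e3 := hC ρ (by simp [hρ]) (w t) (by simp)
  have e4 := bd h _ h1.le (hC ξ' (by simp) σ (by simp [hσ]))
  have e5 := bd h _ h1.le (hC ρ (by simp [hρ]) w' (by simp))
  have e6 := bd (h * h) _ (by rw [abs_mul]; nlinarith [abs_nonneg h])
    (hC ρ (by simp [hρ]) σ (by simp [hσ]))
  rw [abs_le] at *
  constructor <;> linarith [e1.1, e1.2, e2.1, e2.2, e3.1, e3.2, e4.1, e4.2, e5.1, e5.2, e6.1, e6.2]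

/-- A bounded linear form maps smooth curves to smooth functions. -/
lemma SmoothCurveAt.linearMap_comp [T2Space E] (l : E →ₗ[ℝ] ℝ)
    (hl : ∀ A : Set E, Bornology.IsVonNBounded ℝ A → ∃ C : ℝ, ∀ v ∈ A, |l v| ≤ C) {c : ℝ → E}
    {t : ℝ} (hc : SmoothCurveAt c t) : SmoothCurveAt (fun s => l (c s)) t := by
  obtain ⟨d, ⟨D, rfl, hD⟩, hdc⟩ := hc
  refine ⟨fun s => l (D 0 s), ⟨fun n s => l (D n s), rfl, fun n s => ?_⟩, ?_⟩
  · have hs : SmoothCurveAt (D n) s :=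
      SmoothCurve.at ⟨fun k => D (n + k), rfl, fun k => hD (n + k)⟩ s
    -- The form `l` is read as the bilinear form `(a, v) ↦ a * l v`, with constant first argument
    -- `1`.
    have := HasCurveDeriv.hasDerivAt_bilin (B := LinearMap.toSpanSingleton ℝ (E →ₗ[ℝ] ℝ) l)
      (fun A A' hA hA' => ?_) ((smoothCurve_const (1 : ℝ)).at s) hs (HasCurveDeriv.const 1 s)
      (hD n s)
    · simpa [HasCurveDeriv] using hasCurveDeriv_iff_hasDerivAt.2 this
    · obtain ⟨C, hC⟩ := hl A' hA'
      obtain ⟨R, hR⟩ := isVonNBounded_iff_continuous_seminorm.1 hA (normSeminorm ℝ ℝ)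
        continuous_norm
      refine ⟨R * C, fun a ha v hv => ?_⟩
      have h1 : |a| ≤ R := hR a ha
      simp only [LinearMap.toSpanSingleton_apply, LinearMap.smul_apply, smul_eq_mul, abs_mul]
      exact mul_le_mul h1 (hC v hv) (abs_nonneg _) ((abs_nonneg _).trans h1)
  · filter_upwards [hdc] with s hs
    rw [hs]

/-- Near each point, a smooth function is Lipschitz and its second differences are of second
order. -/
lemma SmoothCurveAt.exists_lipschitz {q : ℝ → ℝ} {t : ℝ} (hq : SmoothCurveAt q t) :
    ∃ L r : ℝ, 0 < r ∧
      (∀ s δ : ℝ, |s - t| ≤ r → |δ| ≤ r → |q (s + δ) - q s| ≤ L * |δ|) ∧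
      ∀ s δ : ℝ, |s - t| ≤ r → |δ| ≤ r → |q (s + δ) + q (s - δ) - 2 * q s| ≤ L * δ ^ 2 := by
  obtain ⟨d, hd, hdq⟩ := hq
  obtain ⟨d', hd', hs'⟩ := hd.exists_deriv
  obtain ⟨C, hC⟩ := hd.seminorm_taylor_le hd' (p := normSeminorm ℝ ℝ) continuous_norm t
  obtain ⟨K, hK⟩ := (isCompact_Icc (a := t - 1) (b := t + 1)).bddAbove_image
    hs'.continuous.abs.continuousOn
  obtain ⟨r, hr, hrq⟩ := Metric.eventually_nhds_iff.1 hdq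
  have hq' : ∀ s, |s - t| < r → q s = d s := fun s hs => (hrq (by rwa [Real.dist_eq])).symm
  have hC' : ∀ s h, |s - t| ≤ 1 → |h| ≤ 1 → |d (s + h) - d s - h * d' s| ≤ |C| * h ^ 2 := by
    intro s h hs hh
    exact (hC s h hs hh).trans (by gcongr; exact le_abs_self C)
  -- The radius `r / 3` keeps `s` and `s ± δ` where `q = d`, and 1 is the range of the Taylor
  -- estimate. `|K|` bounds the derivative and `2 * |C|` two Taylor remainders.
  refine ⟨|K| + 2 * |C|, min 1 (r / 3), by positivity, fun s δ hs hδ => ?_, fun s δ hs hδ => ?_⟩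
  all_goals
    have hs1 := hs.trans (min_le_left _ _)
    have hs2 := hs.trans (min_le_right _ _)
    have hδ1 := hδ.trans (min_le_left _ _)
    have hδ2 := hδ.trans (min_le_right _ _)
    have e1 : |s + δ - t| < r := by
      rw [abs_le] at hs2 hδ2; rw [abs_lt]; constructor <;> linarith [hs2.1, hs2.2, hδ2.1, hδ2.2]
    have e2 : |s - δ - t| < r := by
      rw [abs_le] at hs2 hδ2; rw [abs_lt]; constructor <;> linarith [hs2.1, hs2.2, hδ2.1, hδ2.2]
    have h1 := hC' s δ hs1 hδ1
    have h2 := hC' s (-δ) hs1 (by rwa [abs_neg])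
  · rw [hq' _ e1, hq' s (by linarith)]
    have hk : |d' s| ≤ |K| := (hK ⟨s, by
      rw [abs_le] at hs1; constructor <;> linarith [hs1.1, hs1.2], rfl⟩).trans (le_abs_self K)
    have h3 : |δ * d' s| ≤ |K| * |δ| := by rw [abs_mul, mul_comm]; gcongr
    have h4 : |C| * δ ^ 2 ≤ 2 * |C| * |δ| := by
      rw [← sq_abs, sq, two_mul, add_mul]
      have := mul_le_of_le_one_left (abs_nonneg δ) hδ1
      nlinarith [abs_nonneg C, abs_nonneg δ, mul_nonneg (abs_nonneg C) (abs_nonneg δ)]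
    calc |d (s + δ) - d s| = |(d (s + δ) - d s - δ * d' s) + δ * d' s| := by congr 1; ring
      _ ≤ _ := abs_add_le _ _
      _ ≤ (|K| + 2 * |C|) * |δ| := by linarith
  · rw [hq' _ e1, hq' _ e2, hq' s (by linarith)]
    calc |d (s + δ) + d (s - δ) - 2 * d s|
        = |(d (s + δ) - d s - δ * d' s) + (d (s + -δ) - d s - -δ * d' s)| := by
          rw [← sub_eq_add_neg]; congr 1; ring
      _ ≤ _ := abs_add_le _ _
      _ ≤ (|K| + 2 * |C|) * δ ^ 2 := by
          rw [neg_sq] at h2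
          nlinarith [mul_nonneg (abs_nonneg K) (sq_nonneg δ)]

end Taylor

/-! ## Curves through rapidly converging sequences -/

section SpecialCurve

/-- In its window `2 ^ n * τ` lies between `3 / 4` and `5 / 4`; doubling it at least once leaves
that interval. Hence the windows are disjoint. -/
lemma window_unique {n m : ℕ} {τ : ℝ} (hn : |2 ^ n * τ - 1| < 1 / 4)
    (hm : |2 ^ m * τ - 1| < 1 / 4) : n = m := by
  have key : ∀ n m : ℕ, n < m → |2 ^ n * τ - 1| < 1 / 4 → |2 ^ m * τ - 1| < 1 / 4 → False := by
    intro n m h hn hm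
    obtain ⟨k, rfl⟩ := Nat.exists_eq_add_of_lt h
    rw [abs_lt] at hn hm
    have h1 : (1 : ℝ) ≤ 2 ^ k := one_le_pow₀ (by norm_num)
    have h2 : (2 : ℝ) ^ (n + k + 1) * τ = 2 ^ k * (2 * (2 ^ n * τ)) := by ring
    rw [h2] at hm
    nlinarith [hn.1, hn.2, hm.1, hm.2]
  rcases lt_trichotomy n m with h | h | h
  · exact (key n m h hn hm).elim
  · exact h
  · exact (key m n h hm hn).elim

/-- Sequences that decay faster than all the powers of `2 ^ (-n)`. -/
def RapidlyDecaying (α : ℕ → ℝ) : Prop := ∀ k : ℕ, ∃ C, ∀ n, |α n| * (2 ^ n) ^ k ≤ C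

lemma RapidlyDecaying.mul_two_pow {α : ℕ → ℝ} (hα : RapidlyDecaying α) :
    RapidlyDecaying fun n => α n * 2 ^ n := fun k => by
  obtain ⟨C, hC⟩ := hα (k + 1)
  refine ⟨C, fun n => (le_of_eq ?_).trans (hC n)⟩
  rw [abs_mul, abs_of_pos (by positivity : (0 : ℝ) < 2 ^ n)]; ring

lemma RapidlyDecaying.mono {α β : ℕ → ℝ} (hα : RapidlyDecaying α) (h : ∀ n, |β n| ≤ |α n|) :
    RapidlyDecaying β := fun k => by
  obtain ⟨C, hC⟩ := hα k
  exact ⟨C, fun n => (mul_le_mul_of_nonneg_right (h n) (by positivity)).trans (hC n)⟩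

/-- The rapidly decaying sequence `2 ^ (-n²)`. -/
noncomputable def rapidSeq (n : ℕ) : ℝ := (1 / 2) ^ (n ^ 2)

lemma rapidSeq_pos (n : ℕ) : 0 < rapidSeq n := by unfold rapidSeq; positivity

lemma rapidSeq_le_one (n : ℕ) : rapidSeq n ≤ 1 := pow_le_one₀ (by norm_num) (by norm_num)

lemma rapidlyDecaying_rapidSeq : RapidlyDecaying rapidSeq := fun k => by
  -- The bound amounts to `n * k ≤ n ^ 2 + k ^ 2`.
  refine ⟨2 ^ (k ^ 2), fun n => ?_⟩
  rw [abs_of_pos (rapidSeq_pos n), rapidSeq, one_div, inv_pow, inv_mul_le_iff₀ (by positivity),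
    ← pow_mul, ← pow_add]
  refine pow_le_pow_right₀ (by norm_num) ?_
  nlinarith [sq_nonneg ((n : ℤ) - k), Nat.zero_le (n * k), two_mul_le_add_sq n k]

lemma tendsto_rapidSeq : Tendsto rapidSeq atTop (𝓝 0) := by
  refine squeeze_zero (fun n => (rapidSeq_pos n).le) (fun n => ?_)
    (tendsto_pow_atTop_nhds_zero_of_lt_one (r := (1 / 2 : ℝ)) (by norm_num) (by norm_num))
  exact pow_le_pow_of_le_one (by norm_num) (by norm_num) (by nlinarith [Nat.le_self_pow two_ne_zero n])

variable {E : Type*} [AddCommGroup E] [Module ℝ E] [TopologicalSpace E]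

open Classical in
/-- The curve that equals `α n • θ (2 ^ n * τ - 1) • v n` on the `n`-th window
`|2 ^ n * τ - 1| < 1 / 4`. -/
noncomputable def windowCurve (θ : ℝ → ℝ) (α : ℕ → ℝ) (v : ℕ → E) (τ : ℝ) : E :=
  if h : ∃ n : ℕ, |2 ^ n * τ - 1| < 1 / 4 then
    (α h.choose * θ (2 ^ h.choose * τ - 1)) • v h.choose else 0

lemma windowCurve_of_mem (θ : ℝ → ℝ) (α : ℕ → ℝ) (v : ℕ → E) {τ : ℝ} {n : ℕ}
    (h : |2 ^ n * τ - 1| < 1 / 4) :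
    windowCurve θ α v τ = (α n * θ (2 ^ n * τ - 1)) • v n := by
  have h' : ∃ n : ℕ, |2 ^ n * τ - 1| < 1 / 4 := ⟨n, h⟩
  rw [windowCurve, dif_pos h', window_unique h'.choose_spec h]

lemma windowCurve_of_notMem (θ : ℝ → ℝ) (α : ℕ → ℝ) (v : ℕ → E) {τ : ℝ}
    (h : ¬ ∃ n : ℕ, |2 ^ n * τ - 1| < 1 / 4) : windowCurve θ α v τ = 0 := dif_neg h

lemma windowCurve_zero (θ : ℝ → ℝ) (α : ℕ → ℝ) (v : ℕ → E) : windowCurve θ α v 0 = 0 :=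
  windowCurve_of_notMem _ _ _ (by norm_num)

lemma deriv_eq_zero_of_support {θ : ℝ → ℝ} (h0 : ∀ s, 1 / 5 < |s| → θ s = 0) {s : ℝ}
    (hs : 1 / 5 < |s|) : deriv θ s = 0 := by
  have : θ =ᶠ[𝓝 s] fun _ => 0 := by
    filter_upwards [continuous_abs.continuousAt.eventually (lt_mem_nhds hs)] with r hr
    exact h0 r hr
  rw [this.deriv_eq, deriv_const]

variable [IsTopologicalAddGroup E] [ContinuousSMul ℝ E] [LocallyConvexSpace ℝ E]

/-- The derivative is again a window curve, with `deriv θ` and `α n * 2 ^ n` in place of `θ` and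
`α`, and rapid decay survives the factor `2 ^ n`; so smoothness follows by induction. The delicate
point is `τ = 0`, where the windows accumulate and the decay of `α` is needed. -/
lemma windowCurve_hasCurveDeriv {θ : ℝ → ℝ} (hθ : Differentiable ℝ θ)
    (h0 : ∀ s, 1 / 5 < |s| → θ s = 0) {α : ℕ → ℝ} (hα : RapidlyDecaying α) {v : ℕ → E}
    (hv : Bornology.IsVonNBounded ℝ (range v)) (τ : ℝ) :
    HasCurveDeriv (windowCurve θ α v)
      (windowCurve (deriv θ) (fun n => α n * 2 ^ n) v τ) τ := by
  by_cases h : ∃ n : ℕ, |2 ^ n * τ - 1| < 1 / 4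
  · obtain ⟨n, hn⟩ := h
    rw [windowCurve_of_mem _ _ _ hn]
    have hev : ∀ᶠ s in 𝓝 τ, |2 ^ n * s - 1| < 1 / 4 :=
      (show ContinuousAt (fun s : ℝ => |2 ^ n * s - 1|) τ by fun_prop).eventually (gt_mem_nhds hn)
    have hd : HasDerivAt (fun s => α n * θ (2 ^ n * s - 1))
        (α n * 2 ^ n * deriv θ (2 ^ n * τ - 1)) τ := by
      have h1 : HasDerivAt (fun s : ℝ => 2 ^ n * s - 1) (2 ^ n) τ := by
        simpa using ((hasDerivAt_id τ).const_mul ((2 : ℝ) ^ n)).sub_const 1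
      have := ((hθ (2 ^ n * τ - 1)).hasDerivAt.comp τ h1).const_mul (α n)
      refine this.congr_deriv ?_
      ring
    refine (HasCurveDeriv.smul_const hd (v n)).congr ?_
    filter_upwards [hev] with s hs
    rw [windowCurve_of_mem _ _ _ hs]
  rw [windowCurve_of_notMem _ _ _ h]
  by_cases hτ : τ = 0
  · subst hτ
    rw [HasCurveDeriv, tendsto_iff_continuous_seminorm]
    intro p hp ε hε
    simp only [zero_add, windowCurve_zero, sub_zero]
    obtain ⟨R, hR⟩ := isVonNBounded_iff_continuous_seminorm.1 hv p hp
    obtain ⟨C, hC⟩ := hα 2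
    obtain ⟨K, hK⟩ := (isCompact_Icc (a := (-1 : ℝ)) (b := 1)).bddAbove_image
      hθ.continuous.abs.continuousOn
    have hC0 : 0 ≤ C := le_trans (by positivity) (hC 0)
    have hlim : ∀ᶠ h in 𝓝 (0 : ℝ), 4 * |h| * (C * |K| * |R|) < ε :=
      (show ContinuousAt (fun h : ℝ => 4 * |h| * (C * |K| * |R|)) 0 by fun_prop).eventually
        (gt_mem_nhds (by simpa using hε))
    filter_upwards [nhdsWithin_le_nhds hlim, self_mem_nhdsWithin] with h hh hne
    by_cases hw : ∃ n : ℕ, |2 ^ n * h - 1| < 1 / 4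
    · obtain ⟨n, hn⟩ := hw
      rw [windowCurve_of_mem _ _ _ hn, map_smul_eq_mul, map_smul_eq_mul, Real.norm_eq_abs,
        Real.norm_eq_abs, abs_mul, abs_inv]
      refine lt_of_le_of_lt ?_ hh
      have h2 : (0 : ℝ) < 2 ^ n := by positivity
      rw [abs_lt] at hn
      have hpos : 0 < h := by
        by_contra hneg
        nlinarith [hn.1, mul_nonneg h2.le (neg_nonneg.2 (not_lt.1 hneg))]
      rw [abs_of_pos hpos]
      have e1 : |θ (2 ^ n * h - 1)| ≤ |K| :=
        (hK ⟨_, ⟨by linarith [hn.1], by linarith [hn.2]⟩, rfl⟩).trans (le_abs_self K)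
      have e2 : p (v n) ≤ |R| := (hR _ ⟨n, rfl⟩).trans (le_abs_self R)
      -- In the window `2 ^ n * h` exceeds `1 / 2`, so decay of order 2 becomes a bound by `h ^ 2`;
      -- a factor `h` survives the division by `h`.
      have e3 : |α n| ≤ 4 * h ^ 2 * C := by
        have h4 : 1 ≤ 2 * (2 ^ n * h) := by linarith [hn.1]
        have h5 : 1 ≤ 4 * h ^ 2 * (2 ^ n) ^ 2 := by nlinarith
        calc |α n| ≤ |α n| * (4 * h ^ 2 * (2 ^ n) ^ 2) := le_mul_of_one_le_right (abs_nonneg _) h5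
          _ = 4 * h ^ 2 * (|α n| * (2 ^ n) ^ 2) := by ring
          _ ≤ _ := by gcongr; exact hC n
      rw [inv_mul_le_iff₀ hpos]
      calc |α n| * |θ (2 ^ n * h - 1)| * p (v n) ≤ 4 * h ^ 2 * C * |K| * |R| := by gcongr
        _ = _ := by ring
    · rw [windowCurve_of_notMem _ _ _ hw]
      simpa using hε
  · refine (HasCurveDeriv.const (0 : E) τ).congr ?_
    -- A relative error of `1 / 100` cannot bridge the gap between the support `1 / 5` and the
    -- window `1 / 4`, so the curve vanishes near a `τ ≠ 0` outside the windows.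
    have hd : ∀ᶠ s in 𝓝 τ, |s - τ| < |τ| / 100 :=
      (show ContinuousAt (fun s : ℝ => |s - τ|) τ by fun_prop).eventually
        (gt_mem_nhds (by simpa using hτ))
    filter_upwards [hd] with s hs
    by_cases hw : ∃ n : ℕ, |2 ^ n * s - 1| < 1 / 4
    · obtain ⟨n, hn⟩ := hw
      rw [windowCurve_of_mem _ _ _ hn]
      rw [h0, mul_zero, zero_smul]
      by_contra hcon
      refine h ⟨n, ?_⟩
      have h2 : (0 : ℝ) < 2 ^ n := by positivity
      have h3 : |2 ^ n * (s - τ)| ≤ |2 ^ n * τ| / 100 := by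
        rw [abs_mul, abs_mul, mul_div_assoc]; gcongr
      have h4 : |2 ^ n * s - 1| ≤ 1 / 5 := not_lt.1 hcon
      have h5 : 2 ^ n * (s - τ) = 2 ^ n * s - 2 ^ n * τ := by ring
      rw [h5] at h3
      rcases abs_cases (2 ^ n * τ) with h6 | h6 <;> rw [h6.1] at h3 <;> rw [abs_le] at h3 h4 <;>
        rw [abs_lt] <;> constructor <;> linarith [h3.1, h3.2, h4.1, h4.2]
    · rw [windowCurve_of_notMem _ _ _ hw]

lemma smoothCurve_windowCurve [T2Space E] {θ : ℝ → ℝ} (hθ : ContDiff ℝ (⊤ : ℕ∞) θ)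
    (h0 : ∀ s, 1 / 5 < |s| → θ s = 0) {α : ℕ → ℝ} (hα : RapidlyDecaying α) {v : ℕ → E}
    (hv : Bornology.IsVonNBounded ℝ (range v)) : SmoothCurve (windowCurve θ α v) := by
  refine smoothCurve_of_curveDiff fun n => ?_
  induction n generalizing θ α with
  | zero => trivial
  | succ n ih =>
    have hθ' := contDiff_infty_iff_deriv.1 hθ
    exact ⟨_, windowCurve_hasCurveDeriv hθ'.1 h0 hα hv,
      ih hθ'.2 (fun s hs => deriv_eq_zero_of_support h0 hs) hα.mul_two_pow⟩

/-- A smooth curve that runs through short segments at rapidly converging points. -/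
lemma exists_special_curve [T2Space E] (x : E) {v w : ℕ → E}
    (hv : Bornology.IsVonNBounded ℝ (range v)) (hw : Bornology.IsVonNBounded ℝ (range w)) :
    ∃ γ : ℝ → E, SmoothCurve γ ∧ γ 0 = x ∧ ∀ (n : ℕ) (s : ℝ), |s| ≤ 1 / 8 →
      γ ((1 / 2) ^ n + s * (1 / 2) ^ n) = x + rapidSeq n ^ 3 • v n + (rapidSeq n * s) • w n := by
  -- The bump is supported within the radius `1 / 5` allowed for window curves and equals 1 up to `1
  -- / 8`, where the profile `s * b s` is linear and traces the segment.
  let b : ContDiffBump (0 : ℝ) := ⟨1 / 8, 1 / 5, by norm_num, by norm_num⟩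
  have hb0 : ∀ s, 1 / 5 < |s| → b s = 0 := fun s hs => by
    by_contra h
    have : s ∈ Function.support b := h
    rw [b.support_eq, mem_ball_zero_iff] at this
    exact absurd this (not_lt.2 hs.le)
  have hb1 : ∀ s, |s| ≤ 1 / 8 → b s = 1 := fun s hs =>
    b.one_of_mem_closedBall (mem_closedBall_zero_iff.2 hs)
  have hα3 : RapidlyDecaying fun n => rapidSeq n ^ 3 := rapidlyDecaying_rapidSeq.mono fun n => by
    rw [abs_of_pos (pow_pos (rapidSeq_pos n) 3), abs_of_pos (rapidSeq_pos n)]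
    exact pow_le_of_le_one (rapidSeq_pos n).le (rapidSeq_le_one n) (by norm_num)
  refine ⟨fun τ => x + windowCurve b (fun n => rapidSeq n ^ 3) v τ
      + windowCurve (fun s => s * b s) rapidSeq w τ, ?_, ?_, fun n s hs => ?_⟩
  · exact ((smoothCurve_const x).add (smoothCurve_windowCurve b.contDiff hb0 hα3 hv)).add
      (smoothCurve_windowCurve (contDiff_id.mul b.contDiff)
        (fun s hs => by simp only [hb0 s hs, mul_zero]) rapidlyDecaying_rapidSeq hw)
  · simp [windowCurve_zero]
  · have h1 : (2 : ℝ) ^ n * ((1 / 2) ^ n + s * (1 / 2) ^ n) - 1 = s := by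
      have : (2 : ℝ) ^ n * (1 / 2) ^ n = 1 := by rw [← mul_pow]; norm_num
      linear_combination (1 + s) * this
    have h2 : |(2 : ℝ) ^ n * ((1 / 2) ^ n + s * (1 / 2) ^ n) - 1| < 1 / 4 := by
      rw [h1]; linarith
    simp only [windowCurve_of_mem _ _ _ h2, h1, hb1 s hs, mul_one]

/-! ### Linearity of the differential and the chain rule -/

lemma eventually_half_pow_le {r : ℝ} (hr : 0 < r) : ∀ᶠ n : ℕ in atTop, (1 / 2 : ℝ) ^ n ≤ r :=
  (tendsto_pow_atTop_nhds_zero_of_lt_one (by norm_num) (by norm_num)).eventually_le_const hr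

variable [T2Space E]

/-- Along short segments at rapidly converging points, a smooth function has small first and second
differences. -/
lemma CSmoothAt.special_estimates {g : E → ℝ} {x : E} (hg : CSmoothAt g x) {v w : ℕ → E}
    (hv : Bornology.IsVonNBounded ℝ (range v)) (hw : Bornology.IsVonNBounded ℝ (range w)) :
    ∃ L, ∀ᶠ n in atTop, ∀ s : ℝ, |s| ≤ 1 / 8 →
      |g (x + rapidSeq n ^ 3 • v n + (rapidSeq n * s) • w n) - g (x + rapidSeq n ^ 3 • v n)|
        ≤ L * |s| ∧
      |g (x + rapidSeq n ^ 3 • v n + (rapidSeq n * s) • w n)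
        + g (x + rapidSeq n ^ 3 • v n + (rapidSeq n * -s) • w n)
        - 2 * g (x + rapidSeq n ^ 3 • v n)| ≤ L * s ^ 2 := by
  obtain ⟨γ, hγ, hγ0, hγs⟩ := exists_special_curve x hv hw
  obtain ⟨L, r, hr, h1, h2⟩ := (hg γ 0 (hγ.at 0) hγ0).exists_lipschitz
  have hL : 0 ≤ L := by
    have := (abs_nonneg _).trans (h1 0 r (by simpa using hr.le) (abs_of_pos hr).le)
    exact nonneg_of_mul_nonneg_left this (abs_pos.2 hr.ne')
  refine ⟨L, ?_⟩
  -- The centre `(1 / 2) ^ n` and the time increment `s * (1 / 2) ^ n` of the window must both lie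
  -- in the range of the one-variable estimates. The factor `(1 / 2) ^ n` is discarded at the end.
  filter_upwards [eventually_half_pow_le hr] with n hn s hs
  have hp : (0 : ℝ) < (1 / 2) ^ n := by positivity
  have hp1 : (1 / 2 : ℝ) ^ n ≤ 1 := pow_le_one₀ (by norm_num) (by norm_num)
  have hδ : |s * (1 / 2) ^ n| ≤ r := by
    rw [abs_mul, abs_of_pos hp]; nlinarith [abs_nonneg s]
  have hs0 : |(1 / 2 : ℝ) ^ n - 0| ≤ r := by rwa [sub_zero, abs_of_pos hp]
  have e1 := h1 _ _ hs0 hδ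
  have e2 := h2 _ _ hs0 hδ
  have g0 := hγs n 0 (by norm_num)
  have g1 := hγs n s hs
  have g2 := hγs n (-s) (by rwa [abs_neg])
  rw [zero_mul, add_zero, mul_zero, zero_smul, add_zero] at g0
  rw [neg_mul, ← sub_eq_add_neg] at g2
  rw [g0, g1] at e1 e2
  rw [g2] at e2
  refine ⟨e1.trans ?_, e2.trans ?_⟩
  · rw [abs_mul, abs_of_pos hp]
    exact mul_le_mul_of_nonneg_left (mul_le_of_le_one_right (abs_nonneg s) hp1) hL
  · rw [mul_pow]
    exact mul_le_mul_of_nonneg_left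
      (mul_le_of_le_one_right (sq_nonneg s) (pow_le_one₀ hp.le hp1)) hL

lemma isVonNBounded_range_const (v : E) :
    Bornology.IsVonNBounded ℝ (range fun _ : ℕ => v) := by
  rw [range_const]; exact (Set.toFinite _).isVonNBounded

/-- The sequence of difference quotients along `rapidSeq n ^ 3`. -/
lemma HasCurveDeriv.tendsto_rapidSeq {q : ℝ → ℝ} {a t : ℝ} (h : HasCurveDeriv q a t) :
    Tendsto (fun n => (rapidSeq n ^ 3)⁻¹ * (q (t + rapidSeq n ^ 3) - q t)) atTop (𝓝 a) := by
  refine Tendsto.comp (f := fun n => rapidSeq n ^ 3) h (tendsto_nhdsWithin_iff.2 ⟨?_, ?_⟩)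
  · simpa using _root_.tendsto_rapidSeq.pow 3
  · exact Eventually.of_forall fun n => (pow_pos (rapidSeq_pos n) 3).ne'

lemma eventually_rapidSeq_pow_le {k : ℕ} (hk : k ≠ 0) : ∀ᶠ n in atTop, rapidSeq n ^ k ≤ 1 / 8 := by
  have := tendsto_rapidSeq.pow k
  rw [zero_pow hk] at this
  exact this.eventually_le_const (by norm_num)

lemma tendsto_inv_rapidSeq_mul_zero {u : ℕ → ℝ} {L : ℝ}
    (h : ∀ᶠ n in atTop, |u n| ≤ L * rapidSeq n ^ 4) :
    Tendsto (fun n => (rapidSeq n ^ 3)⁻¹ * u n) atTop (𝓝 0) := by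
  have hl : Tendsto (fun n => L * rapidSeq n) atTop (𝓝 0) := by
    simpa using tendsto_rapidSeq.const_mul L
  refine squeeze_zero_norm' ?_ hl
  filter_upwards [h] with n hn
  have hp := pow_pos (rapidSeq_pos n) 3
  rw [norm_mul, norm_inv, Real.norm_eq_abs, Real.norm_eq_abs, abs_of_pos hp, inv_mul_le_iff₀ hp]
  exact hn.trans (le_of_eq (by ring))

/-- The second difference of `g` with step `ε ^ 3 • w` about `x + ε ^ 3 • m` is `O(ε ^ 4)` for `ε =
rapidSeq n`, hence negligible after division by `ε ^ 3`. -/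
lemma CSmoothAt.real_cdiff_midpoint {g : E → ℝ} {x : E} (hg : CSmoothAt g x) (m w : E) :
    cdiff g x (m + w) + cdiff g x (m - w) = 2 * cdiff g x m := by
  obtain ⟨L, hL⟩ := hg.special_estimates (isVonNBounded_range_const m) (isVonNBounded_range_const w)
  have h1 := (hg.hasCurveDeriv_line (m + w)).tendsto_rapidSeq
  have h2 := (hg.hasCurveDeriv_line (m - w)).tendsto_rapidSeq
  have h3 := (hg.hasCurveDeriv_line m).tendsto_rapidSeq
  simp only [zero_add, zero_smul, add_zero] at h1 h2 h3
  have h4 := (h1.add h2).sub (h3.const_mul 2)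
  have h5 : Tendsto (fun n => (rapidSeq n ^ 3)⁻¹ * (g (x + rapidSeq n ^ 3 • (m + w))
      + g (x + rapidSeq n ^ 3 • (m - w)) - 2 * g (x + rapidSeq n ^ 3 • m))) atTop (𝓝 0) := by
    refine tendsto_inv_rapidSeq_mul_zero (L := L) ?_
    filter_upwards [hL, eventually_rapidSeq_pow_le two_ne_zero] with n hn h8
    -- With `s = ε ^ 2` the displacement `ε * s` is the step `ε ^ 3`, while the bound `s ^ 2` is `ε
    -- ^ 4`.
    have := (hn (rapidSeq n ^ 2) (by rwa [abs_of_nonneg (sq_nonneg _)])).2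
    have e1 : x + rapidSeq n ^ 3 • (m + w) =
        x + rapidSeq n ^ 3 • m + (rapidSeq n * rapidSeq n ^ 2) • w := by module
    have e2 : x + rapidSeq n ^ 3 • (m - w) =
        x + rapidSeq n ^ 3 • m + (rapidSeq n * -rapidSeq n ^ 2) • w := by module
    rw [e1, e2]
    exact this.trans (le_of_eq (by ring))
  have := tendsto_nhds_unique h4 (h5.congr fun n => by ring)
  linarith

/-- At the times `ε ^ 3` the curve differs from its tangent line by `ε ^ 6` times a bounded
sequence; the first difference estimate shows that `g` does not see this after division by `ε ^ 3`.
-/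
lemma CSmoothAt.real_cdiff_curve {g : E → ℝ} {c : ℝ → E} {v : E} {t a : ℝ}
    (hg : CSmoothAt g (c t)) (hc : SmoothCurveAt c t) (hv : HasCurveDeriv c v t)
    (ha : HasCurveDeriv (fun s => g (c s)) a t) : a = cdiff g (c t) v := by
  obtain ⟨A, hA, hρ⟩ := hc.taylor_bounded hv
  have hev : ∀ᶠ n in atTop, ∃ ρ ∈ A, c (t + rapidSeq n ^ 3) =
      c t + rapidSeq n ^ 3 • v + (rapidSeq n ^ 3) ^ 2 • ρ := by
    have : Tendsto (fun n => rapidSeq n ^ 3) atTop (𝓝 0) := by simpa using tendsto_rapidSeq.pow 3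
    exact this.eventually hρ
  -- The Taylor formula holds only for large `n`; the default `0` keeps the whole sequence bounded.
  have hex : ∀ n, ∃ w : E, w ∈ A ∪ {0} ∧
      ((∃ ρ ∈ A, c (t + rapidSeq n ^ 3) =
        c t + rapidSeq n ^ 3 • v + (rapidSeq n ^ 3) ^ 2 • ρ) → c (t + rapidSeq n ^ 3) =
        c t + rapidSeq n ^ 3 • v + (rapidSeq n ^ 3) ^ 2 • w) := by
    intro n
    by_cases h : ∃ ρ ∈ A, c (t + rapidSeq n ^ 3) =
        c t + rapidSeq n ^ 3 • v + (rapidSeq n ^ 3) ^ 2 • ρ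
    · obtain ⟨ρ, hρA, hρ'⟩ := h
      exact ⟨ρ, Or.inl hρA, fun _ => hρ'⟩
    · exact ⟨0, by simp, fun h' => (h h').elim⟩
  choose w hw using hex
  have hwb : Bornology.IsVonNBounded ℝ (range w) :=
    (hA.union (Set.toFinite {(0 : E)}).isVonNBounded).subset (by rintro _ ⟨n, rfl⟩; exact (hw n).1)
  obtain ⟨L, hL⟩ := hg.special_estimates (isVonNBounded_range_const v) hwb
  have hL0 : 0 ≤ L := by
    obtain ⟨n, hn⟩ := hL.exists
    have := (abs_nonneg _).trans (hn (1 / 8) (by norm_num)).1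
    norm_num at this
    exact this
  have h1 := (hg.hasCurveDeriv_line v).tendsto_rapidSeq
  have h2 := ha.tendsto_rapidSeq
  simp only [zero_add, zero_smul, add_zero] at h1
  have h5 : Tendsto (fun n => (rapidSeq n ^ 3)⁻¹ * (g (c (t + rapidSeq n ^ 3))
      - g (c t + rapidSeq n ^ 3 • v))) atTop (𝓝 0) := by
    refine tendsto_inv_rapidSeq_mul_zero (L := L) ?_
    filter_upwards [hL, hev, eventually_rapidSeq_pow_le (k := 5) (by norm_num)] with n hn hc h8
    have h0 := rapidSeq_pos n
    -- With `s = ε ^ 5` the displacement `ε * s` is `(ε ^ 3) ^ 2`, the scale of the remainder, and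
    -- the error is at most `L * ε ^ 5 ≤ L * ε ^ 4`.
    have := (hn (rapidSeq n ^ 5) (by rwa [abs_of_pos (by positivity)])).1
    rw [(hw n).2 hc]
    have e : (rapidSeq n ^ 3) ^ 2 = rapidSeq n * rapidSeq n ^ 5 := by ring
    rw [e]
    refine this.trans ?_
    rw [abs_of_pos (by positivity)]
    exact mul_le_mul_of_nonneg_left
      (pow_le_pow_of_le_one h0.le (rapidSeq_le_one n) (by norm_num)) hL0
  have := tendsto_nhds_unique (h2.sub h1) (h5.congr fun n => by ring)
  linarith

variable {F : Type*} [AddCommGroup F] [Module ℝ F] [TopologicalSpace F]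
  [IsTopologicalAddGroup F] [ContinuousSMul ℝ F] [LocallyConvexSpace ℝ F] [T2Space F]

lemma eq_of_forall_dual {x y : F} (h : ∀ l : F →L[ℝ] ℝ, l x = l y) : x = y := by
  by_contra hxy
  obtain ⟨l, hl⟩ := geometric_hahn_banach_point_point hxy
  exact hl.ne (h l)

lemma CSmoothAt.map_cdiff {f : E → F} {x : E} (hf : CSmoothAt f x) (l : F →L[ℝ] ℝ) (v : E) :
    l (cdiff f x v) = cdiff (fun y => l (f y)) x v :=
  (HasCurveDeriv.cdiff_eq (f := fun y => l (f y)) ((hf.hasCurveDeriv_line v).map l)).symm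

lemma CSmoothAt.cdiff_smul {f : E → F} {x : E} (hf : CSmoothAt f x) (a : ℝ) (v : E) :
    cdiff f x (a • v) = a • cdiff f x v := by
  refine HasCurveDeriv.cdiff_eq ?_
  have h1 : HasDerivAt (fun s : ℝ => s * a) a 0 := by simpa using (hasDerivAt_id (0 : ℝ)).mul_const a
  have := HasCurveDeriv.comp (c := fun t : ℝ => f (x + t • v)) (φ := fun s => s * a) (t := 0)
    (by rw [zero_mul]; exact hf.hasCurveDeriv_line v) h1
  simpa [smul_smul] using this

/-- Continuous functionals separate points, which reduces to real functions; there additivity is the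
midpoint identity at `(u + v) / 2` with increment `(u - v) / 2`, together with homogeneity. -/
lemma CSmoothAt.cdiff_add {f : E → F} {x : E} (hf : CSmoothAt f x) (u v : E) :
    cdiff f x (u + v) = cdiff f x u + cdiff f x v := by
  refine eq_of_forall_dual fun l => ?_
  have hl := hf.map l
  rw [map_add, hf.map_cdiff, hf.map_cdiff, hf.map_cdiff]
  have h := hl.real_cdiff_midpoint ((1 / 2 : ℝ) • (u + v)) ((1 / 2 : ℝ) • (u - v))
  rw [hl.cdiff_smul, smul_eq_mul] at h
  have e1 : (1 / 2 : ℝ) • (u + v) + (1 / 2 : ℝ) • (u - v) = u := by module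
  have e2 : (1 / 2 : ℝ) • (u + v) - (1 / 2 : ℝ) • (u - v) = v := by module
  rw [e1, e2] at h
  linarith

/-- The chain rule along a smooth curve. -/
lemma CSmoothAt.hasCurveDeriv_comp {f : E → F} {c : ℝ → E} {v : E} {t : ℝ}
    (hf : CSmoothAt f (c t)) (hc : SmoothCurveAt c t) (hv : HasCurveDeriv c v t) :
    HasCurveDeriv (fun s => f (c s)) (cdiff f (c t) v) t := by
  -- Smoothness of `f` along `c` already provides a derivative; functionals then identify it.
  obtain ⟨w, hw⟩ := (hf c t hc rfl).exists_deriv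
  rwa [show cdiff f (c t) v = w from eq_of_forall_dual fun l => by
    rw [hf.map_cdiff, ← (hf.map l).real_cdiff_curve hc hv (hw.map l)]]

lemma CSmoothAt.cdiff_comp {G : Type*} [AddCommGroup G] [Module ℝ G] [TopologicalSpace G]
    [IsTopologicalAddGroup G] [ContinuousSMul ℝ G] [LocallyConvexSpace ℝ G] [T2Space G]
    {g : F → G} {f : E → F} {x : E} (hg : CSmoothAt g (f x)) (hf : CSmoothAt f x) (v : E) :
    cdiff (fun y => g (f y)) x v = cdiff g (f x) (cdiff f x v) := by
  have h := hf _ 0 ((smoothCurve_line x v).at 0) (by simp)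
  have := CSmoothAt.hasCurveDeriv_comp (f := g) (c := fun t : ℝ => f (x + t • v)) (t := 0)
    (by simpa using hg) h (hf.hasCurveDeriv_line v)
  rw [zero_smul, add_zero] at this
  exact HasCurveDeriv.cdiff_eq (f := fun y => g (f y)) this

end SpecialCurve

/-! ## Symmetry of second derivatives -/

section Hessian

variable {E : Type*} [AddCommGroup E] [Module ℝ E] [TopologicalSpace E]
  [IsTopologicalAddGroup E] [ContinuousSMul ℝ E] [LocallyConvexSpace ℝ E] [T2Space E]
variable {F : Type*} [AddCommGroup F] [Module ℝ F] [TopologicalSpace F]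
  [IsTopologicalAddGroup F] [ContinuousSMul ℝ F] [LocallyConvexSpace ℝ F] [T2Space F]

lemma exists_curve_through_rapid (y : E) {w : ℕ → E} (hw : Bornology.IsVonNBounded ℝ (range w)) :
    ∃ γ : ℝ → E, SmoothCurve γ ∧ γ 0 = y ∧ ∀ n, γ ((1 / 2) ^ n) = y + rapidSeq n ^ 3 • w n := by
  obtain ⟨γ, hγ, h0, hs⟩ := exists_special_curve y hw hw
  exact ⟨γ, hγ, h0, fun n => by simpa using hs n 0 (by norm_num)⟩

lemma tendsto_half_pow : Tendsto (fun n : ℕ => (1 / 2 : ℝ) ^ n) atTop (𝓝 0) :=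
  tendsto_pow_atTop_nhds_zero_of_lt_one (by norm_num) (by norm_num)

/-- Smoothness does not supply continuity for the given topology of `E`, but the rapidly converging
points lie on one smooth curve, along which `g` is continuous. -/
lemma CSmoothAt.tendsto_rapid {g : E → ℝ} {y : E} (hg : CSmoothAt g y) {w : ℕ → E}
    (hw : Bornology.IsVonNBounded ℝ (range w)) :
    Tendsto (fun n => g (y + rapidSeq n ^ 3 • w n)) atTop (𝓝 (g y)) := by
  obtain ⟨γ, hγ, h0, hs⟩ := exists_curve_through_rapid y hw
  have := (hg γ 0 (hγ.at 0) h0).continuousAt.tendsto.comp tendsto_half_pow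
  simpa only [Function.comp_def, hs, h0] using this

lemma isVonNBounded_range_add_smul (p q : E) {b : ℕ → ℝ} (hb : ∀ n, b n ∈ Icc (0 : ℝ) 1) :
    Bornology.IsVonNBounded ℝ (range fun n => p + b n • q) := by
  rw [isVonNBounded_iff_continuous_seminorm]
  intro r _
  refine ⟨r p + r q, ?_⟩
  rintro _ ⟨n, rfl⟩
  refine (map_add_le_add r _ _).trans ?_
  rw [map_smul_eq_mul, Real.norm_eq_abs, abs_of_nonneg (hb n).1]
  linarith [mul_le_of_le_one_left (apply_nonneg r q) (hb n).2]

/-- For uniformity in `b`, choose for each `n` a point of the segment outside `V` whenever there is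
one. A smooth curve through the chosen points is eventually in `V`, so for large `n` no bad point
exists. -/
lemma CInftyOpen.eventually_segment_mem {V : Set E} (hV : CInftyOpen V) {y : E} (hy : y ∈ V)
    (p q : E) : ∀ᶠ n in atTop, ∀ b ∈ Icc (0 : ℝ) 1, y + rapidSeq n ^ 3 • (p + b • q) ∈ V := by
  have hex : ∀ n, ∃ b ∈ Icc (0 : ℝ) 1, y + rapidSeq n ^ 3 • (p + b • q) ∈ V →
      ∀ b ∈ Icc (0 : ℝ) 1, y + rapidSeq n ^ 3 • (p + b • q) ∈ V := by
    intro n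
    by_cases h : ∀ b ∈ Icc (0 : ℝ) 1, y + rapidSeq n ^ 3 • (p + b • q) ∈ V
    · exact ⟨0, by simp, fun _ => h⟩
    · push Not at h
      obtain ⟨b, hb, hb'⟩ := h
      exact ⟨b, hb, fun h' => (hb' h').elim⟩
  choose b hb hbV using hex
  obtain ⟨γ, hγ, h0, hs⟩ := exists_curve_through_rapid y (isVonNBounded_range_add_smul p q hb)
  have h1 := tendsto_half_pow.eventually (hV.preimage_mem_nhds (hγ.at 0) (by rwa [h0]))
  filter_upwards [h1] with n hn
  rw [hs] at hn
  exact hbV n hn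

lemma CSmoothAt.hasDerivAt_line {g : E → ℝ} {x v : E} {b : ℝ} (hg : CSmoothAt g (x + b • v)) :
    HasDerivAt (fun s : ℝ => g (x + s • v)) (cdiff g (x + b • v) v) b :=
  hasCurveDeriv_iff_hasDerivAt.1 (CSmoothAt.hasCurveDeriv_comp (c := fun s : ℝ => x + s • v)
    hg ((smoothCurve_line x v).at b) (_root_.hasCurveDeriv_line x v b))

/-- Two mean value theorems in the direction `v`. With `t = rapidSeq n ^ 3`, the first turns the
second difference into `t` times an increment of `κ` in the direction `u`, based at `b₁ • v` with
`b₁ < t`. The second moves the base back to `y`, at the cost of `b₁` times an increment of `cdiff κ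
· v` that tends to zero. Division by `t ^ 2` leaves the difference quotient of `κ` along `u`. -/
lemma tendsto_secondDifference {V : Set E} (hV : CInftyOpen V) {h κ : E → ℝ} {y u v : E}
    (hy : y ∈ V) (hh : ∀ z ∈ V, CSmoothAt h z) (hκ : ∀ z ∈ V, CSmoothAt κ z)
    (hκh : ∀ z ∈ V, κ z = cdiff h z v) (hμ : CSmoothAt (fun z => cdiff κ z v) y) :
    Tendsto (fun n => (rapidSeq n ^ 3)⁻¹ * ((rapidSeq n ^ 3)⁻¹ *
      (h (y + rapidSeq n ^ 3 • u + rapidSeq n ^ 3 • v) - h (y + rapidSeq n ^ 3 • u)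
        - h (y + rapidSeq n ^ 3 • v) + h y))) atTop (𝓝 (cdiff κ y u)) := by
  set t : ℕ → ℝ := fun n => rapidSeq n ^ 3 with ht
  have htp : ∀ n, 0 < t n := fun n => pow_pos (rapidSeq_pos n) 3
  set Ψ₂ : ℕ → ℝ → ℝ := fun n b =>
    cdiff κ (y + t n • (u + b • v)) v - cdiff κ (y + t n • ((0 : E) + b • v)) v with hΨ₂
  have hex : ∀ n, ∃ a ∈ Icc (0 : ℝ) 1, ∃ b ∈ Icc (0 : ℝ) 1,
      ((∀ b ∈ Icc (0 : ℝ) 1, y + t n • (u + b • v) ∈ V) →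
      (∀ b ∈ Icc (0 : ℝ) 1, y + t n • ((0 : E) + b • v) ∈ V) →
      (t n)⁻¹ * ((t n)⁻¹ * (h (y + t n • u + t n • v) - h (y + t n • u) - h (y + t n • v) + h y))
        = (t n)⁻¹ * (κ (y + t n • u) - κ y) + a * Ψ₂ n b) := by
    intro n
    by_cases hall : (∀ b ∈ Icc (0 : ℝ) 1, y + t n • (u + b • v) ∈ V) ∧
      (∀ b ∈ Icc (0 : ℝ) 1, y + t n • ((0 : E) + b • v) ∈ V)
    swap
    -- Default parameters for the finitely many `n` whose segments leave `V`; they keep `a` and `b`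
    -- in the unit interval.
    · exact ⟨0, by simp, 0, by simp, fun h1 h2 => (hall ⟨h1, h2⟩).elim⟩
    obtain ⟨hV1, hV2⟩ := hall
    have htn := htp n
    have mem1 : ∀ b ∈ Icc (0 : ℝ) (t n), y + t n • u + b • v ∈ V := fun b hb => by
      have := hV1 (b / t n) ⟨by have := hb.1; positivity, by rw [div_le_one htn]; exact hb.2⟩
      rwa [smul_add, smul_smul, mul_div_cancel₀ _ htn.ne', ← add_assoc] at this
    have mem2 : ∀ b ∈ Icc (0 : ℝ) (t n), y + b • v ∈ V := fun b hb => by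
      have := hV2 (b / t n) ⟨by have := hb.1; positivity, by rw [div_le_one htn]; exact hb.2⟩
      rwa [zero_add, smul_smul, mul_div_cancel₀ _ htn.ne'] at this
    have d1 : ∀ b ∈ Icc (0 : ℝ) (t n),
        HasDerivAt (fun s : ℝ => h (y + t n • u + s • v) - h (y + s • v))
          (κ (y + t n • u + b • v) - κ (y + b • v)) b := fun b hb => by
      rw [hκh _ (mem1 b hb), hκh _ (mem2 b hb)]
      exact (hh _ (mem1 b hb)).hasDerivAt_line.fun_sub (hh _ (mem2 b hb)).hasDerivAt_line
    have d2 : ∀ b ∈ Icc (0 : ℝ) (t n),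
        HasDerivAt (fun s : ℝ => κ (y + t n • u + s • v) - κ (y + s • v))
          (cdiff κ (y + t n • u + b • v) v - cdiff κ (y + b • v) v) b := fun b hb =>
      (hκ _ (mem1 b hb)).hasDerivAt_line.fun_sub (hκ _ (mem2 b hb)).hasDerivAt_line
    obtain ⟨b₁, hb₁, e₁⟩ := exists_hasDerivAt_eq_slope _ _ htn
      (fun b hb => (d1 b hb).continuousAt.continuousWithinAt)
      (fun b hb => d1 b (Ioo_subset_Icc_self hb))
    have hsub : Icc 0 b₁ ⊆ Icc 0 (t n) := Icc_subset_Icc_right hb₁.2.le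
    obtain ⟨b₂, hb₂, e₂⟩ := exists_hasDerivAt_eq_slope _ _ hb₁.1
      (fun b hb => (d2 b (hsub hb)).continuousAt.continuousWithinAt)
      (fun b hb => d2 b (hsub (Ioo_subset_Icc_self hb)))
    have hb2 := hsub (Ioo_subset_Icc_self hb₂)
    refine ⟨b₁ / t n, ⟨div_nonneg hb₁.1.le htn.le, by rw [div_le_one htn]; exact hb₁.2.le⟩,
      b₂ / t n, ⟨div_nonneg hb2.1 htn.le, by rw [div_le_one htn]; exact hb2.2⟩, fun _ _ => ?_⟩
    simp only [zero_smul, add_zero, sub_zero] at e₁ e₂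
    have e₃ : Ψ₂ n (b₂ / t n) = cdiff κ (y + t n • u + b₂ • v) v - cdiff κ (y + b₂ • v) v := by
      simp only [hΨ₂, zero_add, smul_add, smul_smul, mul_div_cancel₀ _ htn.ne', add_assoc]
    rw [e₃, e₂]
    have hb₁' := hb₁.1.ne'
    rw [eq_div_iff htn.ne'] at e₁
    have e₄ : h (y + t n • u + t n • v) - h (y + t n • u) - h (y + t n • v) + h y
        = (κ (y + t n • u + b₁ • v) - κ (y + b₁ • v)) * t n := by rw [e₁]; ring
    rw [e₄]
    field_simp
    ring
  choose a ha b hb hab using hex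
  have l1 : Tendsto (fun n => (t n)⁻¹ * (κ (y + t n • u) - κ y)) atTop (𝓝 (cdiff κ y u)) := by
    simpa using ((hκ y hy).hasCurveDeriv_line u).tendsto_rapidSeq
  have l2 : Tendsto (fun n => Ψ₂ n (b n)) atTop (𝓝 0) := by
    have := (hμ.tendsto_rapid (isVonNBounded_range_add_smul u v hb)).sub
      (hμ.tendsto_rapid (isVonNBounded_range_add_smul 0 v hb))
    rwa [sub_self] at this
  have l3 : Tendsto (fun n => a n * Ψ₂ n (b n)) atTop (𝓝 0) := by
    refine squeeze_zero_norm (fun n => ?_) (tendsto_zero_iff_norm_tendsto_zero.1 l2)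
    rw [norm_mul, Real.norm_of_nonneg (ha n).1]
    exact mul_le_of_le_one_left (norm_nonneg _) (ha n).2
  have l4 := l1.add l3
  rw [add_zero] at l4
  refine l4.congr' ?_
  filter_upwards [hV.eventually_segment_mem hy u v, hV.eventually_segment_mem hy 0 v] with n h1 h2
  exact (hab n h1 h2).symm

lemma cdiff_congr {V : Set E} (hV : CInftyOpen V) {f g : E → F} {y : E} (hy : y ∈ V)
    (h : ∀ z ∈ V, f z = g z) (v : E) : cdiff f y v = cdiff g y v := by
  have h1 : ∀ᶠ t : ℝ in 𝓝 0, y + t • v ∈ V :=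
    hV.preimage_mem_nhds ((smoothCurve_line y v).at 0) (by simpa using hy)
  have h2 : (fun t : ℝ => t⁻¹ • (f (y + t • v) - f y)) =ᶠ[𝓝[≠] 0]
      fun t : ℝ => t⁻¹ • (g (y + t • v) - g y) := by
    filter_upwards [nhdsWithin_le_nhds h1] with t ht
    rw [h _ ht, h _ hy]
  unfold cdiff limUnder
  rw [map_congr h2]

/-- Both sides are limits of the same second difference quotient, which is symmetric in `u` and `v`.
-/
lemma second_cdiff_symm {V : Set E} (hV : CInftyOpen V) {h : E → ℝ} {κ : E → E → ℝ} {y : E}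
    (hy : y ∈ V) (hh : ∀ z ∈ V, CSmoothAt h z) (hκ : ∀ v, ∀ z ∈ V, CSmoothAt (κ v) z)
    (hκh : ∀ v, ∀ z ∈ V, κ v z = cdiff h z v)
    (hμ : ∀ v, CSmoothAt (fun z => cdiff (κ v) z v) y) (u v : E) :
    cdiff (κ v) y u = cdiff (κ u) y v := by
  have h1 := tendsto_secondDifference hV (u := u) (v := v) hy hh (hκ v) (hκh v) (hμ v)
  have h2 := tendsto_secondDifference hV (u := v) (v := u) hy hh (hκ u) (hκh u) (hμ u)
  refine tendsto_nhds_unique h1 (h2.congr fun n => ?_)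
  rw [add_right_comm y]
  ring

end Hessian

/-! ## Convenient manifolds -/

section Manifold

variable {E : Type*} [AddCommGroup E] [Module ℝ E] [TopologicalSpace E]
  [IsTopologicalAddGroup E] [ContinuousSMul ℝ E] [LocallyConvexSpace ℝ E] [T2Space E]
variable {F : Type*} [AddCommGroup F] [Module ℝ F] [TopologicalSpace F]
  [IsTopologicalAddGroup F] [ContinuousSMul ℝ F] [LocallyConvexSpace ℝ F] [T2Space F]
variable {M : Type*}

lemma cInftyOpen_of_eventually {U : Set E}
    (h : ∀ (c : ℝ → E) (t : ℝ), SmoothCurveAt c t → c t ∈ U → ∀ᶠ s in 𝓝 t, c s ∈ U) :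
    CInftyOpen U := fun c hc =>
  isOpen_iff_mem_nhds.2 fun t ht => h c t (hc.at t) ht

lemma CInftyOpen.prod_univ {U : Set E} (hU : CInftyOpen U) :
    CInftyOpen (U ×ˢ (univ : Set F)) := fun c hc => by
  have := hU _ (hc.map (ContinuousLinearMap.fst ℝ E F))
  convert this using 1
  ext t
  simp

namespace SmoothTransition

variable {e e' : PartialEquiv M E}

lemma cSmoothAt (h : SmoothTransition e e') {y : E} (hy : y ∈ e.target)
    (hy' : e.symm y ∈ e'.source) : CSmoothAt (fun z => e' (e.symm z)) y :=
  h.2.cSmoothAt h.1 (by simpa using ⟨hy, hy'⟩)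

lemma eventually_mem (h : SmoothTransition e e') {c : ℝ → E} {t : ℝ} (hc : SmoothCurveAt c t)
    (ht : c t ∈ e.target) (ht' : e.symm (c t) ∈ e'.source) :
    ∀ᶠ s in 𝓝 t, c s ∈ e.target ∧ e.symm (c s) ∈ e'.source := by
  filter_upwards [h.1.preimage_mem_nhds hc (by simpa using ⟨ht, ht'⟩)] with s hs
  simpa using hs

end SmoothTransition

namespace ConvenientManifold

variable {𝓜 : ConvenientManifold E M}

/-- Locally, the change of charts factors through a chart of the atlas. -/
lemma smoothTransition_of_mem_maximalAtlas {e e' : PartialEquiv M E} (he : e ∈ 𝓜.maximalAtlas)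
    (he' : e' ∈ 𝓜.maximalAtlas) : SmoothTransition e e' := by
  have hsrc : (e.symm.trans e').source = e.target ∩ e.symm ⁻¹' e'.source := by
    simp [PartialEquiv.trans_source]
  have key : ∀ y ∈ (e.symm.trans e').source, CSmoothAt (e' ∘ e.symm) y ∧
      ∀ (c : ℝ → E) (t : ℝ), SmoothCurveAt c t → c t = y →
        ∀ᶠ s in 𝓝 t, c s ∈ (e.symm.trans e').source := by
    intro y hy
    rw [hsrc] at hy ⊢
    obtain ⟨a, ha, hya⟩ := 𝓜.cover (e.symm y)
    have h1 := (he.2 a ha).1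
    have h2 := (he'.2 a ha).2
    have ha1 := h1.cSmoothAt hy.1 hya
    have haa : a.symm (a (e.symm y)) = e.symm y := a.left_inv hya
    constructor
    · have h3 := CSmoothAt.comp (g := fun z => e' (a.symm z)) (f := fun z => a (e.symm z))
        (h2.cSmoothAt (a.map_source hya) (by rw [haa]; exact hy.2)) ha1
      refine h3.congr h1.1 (by simpa using ⟨hy.1, hya⟩) fun z hz => ?_
      have hz' : z ∈ e.target ∧ e.symm z ∈ a.source := by simpa using hz
      rw [a.left_inv hz'.2]; rfl
    · rintro c t hc rfl
      filter_upwards [h1.eventually_mem hc hy.1 hya, h2.eventually_mem (ha1 c t hc rfl)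
        (a.map_source hya) (by rw [haa]; exact hy.2)] with s hs hs'
      rw [a.left_inv hs.2] at hs'
      exact ⟨hs.1, hs'.2⟩
  exact ⟨cInftyOpen_of_eventually fun c t hc ht => (key _ ht).2 c t hc rfl,
    cSmoothOn_of_cSmoothAt fun y hy => (key y hy).1⟩

lemma IsOpenSet.cInftyOpen {U : Set M} (hU : 𝓜.IsOpenSet U) {e : PartialEquiv M E}
    (he : e ∈ 𝓜.maximalAtlas) : CInftyOpen (e.target ∩ e.symm ⁻¹' U) := by
  refine cInftyOpen_of_eventually fun c t hc ht => ?_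
  obtain ⟨a, ha, hya⟩ := 𝓜.cover (e.symm (c t))
  have h1 := (he.2 a ha).1
  have haa : a.symm (a (e.symm (c t))) = e.symm (c t) := a.left_inv hya
  filter_upwards [h1.eventually_mem hc ht.1 hya, (hU a ha).preimage_mem_nhds
    (h1.cSmoothAt ht.1 hya c t hc rfl)
    ⟨a.map_source hya, by rw [mem_preimage, haa]; exact ht.2⟩] with s hs hs'
  have := hs'.2
  rw [mem_preimage, a.left_inv hs.2] at this
  exact ⟨hs.1, this⟩

lemma IsOpenSet.inter {U V : Set M} (hU : 𝓜.IsOpenSet U) (hV : 𝓜.IsOpenSet V) :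
    𝓜.IsOpenSet (U ∩ V) := fun e he => by
  have := (hU e he).inter (hV e he)
  rwa [← inter_inter_distrib_left, ← preimage_inter] at this

lemma SmoothFun.cSmoothAt {U : Set M} (hU : 𝓜.IsOpenSet U) {f : M → ℝ} (hf : 𝓜.SmoothFun U f)
    {e : PartialEquiv M E} (he : e ∈ 𝓜.maximalAtlas) {y : E} (hy : y ∈ e.target)
    (hyU : e.symm y ∈ U) : CSmoothAt (fun z => f (e.symm z)) y := by
  obtain ⟨a, ha, hya⟩ := 𝓜.cover (e.symm y)
  have h1 := (he.2 a ha).1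
  have haa : a.symm (a (e.symm y)) = e.symm y := a.left_inv hya
  have h2 : CSmoothAt (fun z => f (a.symm z)) (a (e.symm y)) :=
    (hf a ha).cSmoothAt (hU a ha) ⟨a.map_source hya, by rw [mem_preimage, haa]; exact hyU⟩
  refine (h2.comp (f := fun z => a (e.symm z)) (h1.cSmoothAt hy hya)).congr h1.1 (by simpa using ⟨hy, hya⟩) fun z hz => ?_
  have hz' : z ∈ e.target ∧ e.symm z ∈ a.source := by simpa using hz
  rw [a.left_inv hz'.2]

lemma SmoothFun.mono {U V : Set M} (h : V ⊆ U) {f : M → ℝ} (hf : 𝓜.SmoothFun U f) :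
    𝓜.SmoothFun V f := fun e he c hc hcV =>
  hf e he c hc fun t => ⟨(hcV t).1, h (hcV t).2⟩

end ConvenientManifold

/-! ## Weak subbundles in coordinates -/

namespace WeakSubbundle

variable {𝓜 : ConvenientManifold E M} (T : WeakSubbundle F 𝓜)

lemma chartAt_mem (x : M) : T.chartAt x ∈ T.charts := (Classical.choose_spec (T.cover x)).1

lemma mem_chartAt_source (x : M) : x ∈ (T.chartAt x).source :=
  (Classical.choose_spec (T.cover x)).2

lemma ext_pairing {ξ η : F} (h : ∀ v, T.pairing ξ v = T.pairing η v) : ξ = η :=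
  T.pairing_injective (LinearMap.ext h)

lemma pairing_lift {l : E → ℝ} (h : ∃ ξ, ∀ v, T.pairing ξ v = l v) (v : E) :
    T.pairing (T.lift l) v = l v := by
  obtain ⟨ξ, hξ⟩ := h
  exact congrFun (Function.invFun_eq (f := fun (ξ : F) (v : E) => T.pairing ξ v) (b := l)
    ⟨ξ, funext hξ⟩) v

variable {T}

lemma smoothTransition {e e' : PartialEquiv M E} (he : e ∈ T.charts) (he' : e' ∈ T.charts) :
    SmoothTransition e e' :=
  ConvenientManifold.smoothTransition_of_mem_maximalAtlas (T.charts_subset he)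
    (T.charts_subset he')

lemma cSmoothAt_chartAt {e : PartialEquiv M E} (he : e ∈ T.charts) {x : M} (hx : x ∈ e.source) :
    CSmoothAt (fun z => e ((T.chartAt x).symm z)) (T.chartAt x x) :=
  (smoothTransition (T.chartAt_mem x) he).cSmoothAt
    ((T.chartAt x).map_source (T.mem_chartAt_source x))
    (by rwa [(T.chartAt x).left_inv (T.mem_chartAt_source x)])

lemma tangentCoord_add {e : PartialEquiv M E} (he : e ∈ T.charts) {x : M} (hx : x ∈ e.source)
    (u v : E) : T.tangentCoord e x (u + v) = T.tangentCoord e x u + T.tangentCoord e x v :=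
  (cSmoothAt_chartAt he hx).cdiff_add u v

lemma tangentCoord_smul {e : PartialEquiv M E} (he : e ∈ T.charts) {x : M} (hx : x ∈ e.source)
    (a : ℝ) (v : E) : T.tangentCoord e x (a • v) = a • T.tangentCoord e x v :=
  (cSmoothAt_chartAt he hx).cdiff_smul a v

lemma tangentCoord_chartAt (x : M) (v : E) : T.tangentCoord (T.chartAt x) x v = v := by
  have hx := T.mem_chartAt_source x
  have h : T.tangentCoord (T.chartAt x) x v = cdiff (fun z : E => z) (T.chartAt x x) v :=
    cdiff_congr (T.charts_subset (T.chartAt_mem x)).1 ((T.chartAt x).map_source hx)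
      (fun z hz => (T.chartAt x).right_inv hz) v
  rw [h]
  exact HasCurveDeriv.cdiff_eq (f := fun z : E => z) (hasCurveDeriv_line _ v 0)

/-- The transition map `τ` of the subbundle provides the representative in `F` that makes `lift`
meaningful. -/
lemma pairing_cotangentOfCoord {e : PartialEquiv M E} (he : e ∈ T.charts) {x : M}
    (hx : x ∈ e.source) (ξ : F) (v : E) :
    T.pairing (T.cotangentOfCoord e x ξ) v = T.pairing ξ (T.tangentCoord e x v) := by
  obtain ⟨τ, -, hτ⟩ := T.transition _ (T.chartAt_mem x) e he
  have hy : T.chartAt x x ∈ ((T.chartAt x).symm.trans e).source := by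
    have h1 := (T.chartAt x).map_source (T.mem_chartAt_source x)
    have h2 := (T.chartAt x).left_inv (T.mem_chartAt_source x)
    simp [PartialEquiv.trans_source, h1, h2, hx]
  exact T.pairing_lift ⟨τ (T.chartAt x x, ξ), fun v => hτ _ hy ξ v⟩ v

lemma cotangentOfCoord_chartAt (x : M) (ξ : F) : T.cotangentOfCoord (T.chartAt x) x ξ = ξ :=
  T.ext_pairing fun v => by
    rw [pairing_cotangentOfCoord (T.chartAt_mem x) (T.mem_chartAt_source x), tangentCoord_chartAt]

lemma cotangentOfCoord_add {e : PartialEquiv M E} (he : e ∈ T.charts) {x : M}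
    (hx : x ∈ e.source) (ξ η : F) : T.cotangentOfCoord e x (ξ + η) =
      T.cotangentOfCoord e x ξ + T.cotangentOfCoord e x η :=
  T.ext_pairing fun v => by simp [pairing_cotangentOfCoord he hx]

lemma cotangentOfCoord_smul {e : PartialEquiv M E} (he : e ∈ T.charts) {x : M}
    (hx : x ∈ e.source) (a : ℝ) (ξ : F) : T.cotangentOfCoord e x (a • ξ) =
      a • T.cotangentOfCoord e x ξ :=
  T.ext_pairing fun v => by simp [pairing_cotangentOfCoord he hx]

lemma cotangentOfCoord_sum {e : PartialEquiv M E} (he : e ∈ T.charts) {x : M}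
    (hx : x ∈ e.source) {ι : Type*} (s : Finset ι) (ξ : ι → F) :
    T.cotangentOfCoord e x (∑ i ∈ s, ξ i) = ∑ i ∈ s, T.cotangentOfCoord e x (ξ i) :=
  T.ext_pairing fun v => by simp [pairing_cotangentOfCoord he hx]

lemma dfun_eq_cdiff {e : PartialEquiv M E} (he : e ∈ T.charts) {x : M} (hx : x ∈ e.source)
    {f : M → ℝ} (hf : CSmoothAt (fun y => f (e.symm y)) (e x)) (v : E) :
    T.dfun f x v = cdiff (fun y => f (e.symm y)) (e x) (T.tangentCoord e x v) := by
  have h1 := cSmoothAt_chartAt (T := T) he hx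
  have hx0 := (T.chartAt x).left_inv (T.mem_chartAt_source x)
  have h2 := CSmoothAt.cdiff_comp (g := fun y => f (e.symm y))
    (f := fun z => e ((T.chartAt x).symm z)) (by rwa [hx0]) h1 v
  rw [hx0] at h2
  refine Eq.trans ?_ h2
  refine cdiff_congr (smoothTransition (T.chartAt_mem x) he).1 ?_ (fun z hz => ?_) v
  · have h3 := (T.chartAt x).map_source (T.mem_chartAt_source x)
    simp [PartialEquiv.trans_source, h3, hx0, hx]
  · have hz' : z ∈ (T.chartAt x).target ∧ (T.chartAt x).symm z ∈ e.source := by simpa using hz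
    rw [e.left_inv hz'.2]; rfl

lemma InA.mono {U V : Set M} (h : V ⊆ U) {f : M → ℝ} (hf : T.InA U f) : T.InA V f := by
  refine ⟨hf.1.mono h, fun e he k => ?_⟩
  obtain ⟨G, hG, hG'⟩ := hf.2 e he k
  exact ⟨G, fun c hc hcV => hG c hc fun t => ⟨⟨(hcV t).1.1, h (hcV t).1.2⟩, mem_univ _⟩,
    fun y hy => hG' y ⟨hy.1, h hy.2⟩⟩

lemma iteratedCdiff_const (a : ℝ) (k : ℕ) (x : E) (u : Fin (k + 1) → E) :
    iteratedCdiff (fun _ : E => a) (k + 1) x u = 0 := by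
  have h0 : ∀ (b : ℝ) (x v : E), cdiff (fun _ : E => b) x v = 0 := fun b x v =>
    HasCurveDeriv.cdiff_eq (HasCurveDeriv.const b 0)
  induction k generalizing x with
  | zero => exact h0 a x _
  | succ k ih =>
    rw [iteratedCdiff]
    simp only [ih]
    exact h0 0 x _

/-- The coefficient `1` is what makes a single differential `df` a section of `𝔓`. -/
lemma inA_const (U : Set M) (a : ℝ) : T.InA U fun _ => a := by
  refine ⟨fun e _ c _ _ => smoothCurve_const a, fun e _ k => ⟨fun _ => 0, fun c _ _ =>
    smoothCurve_const (0 : F), fun y _ u v => ?_⟩⟩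
  rw [map_zero, LinearMap.zero_apply]
  exact (iteratedCdiff_const a k y _).symm

lemma cSmoothAt_prodMk_const {G H : Type*} [AddCommGroup G] [Module ℝ G] [TopologicalSpace G]
    [IsTopologicalAddGroup G] [ContinuousSMul ℝ G]
    [AddCommGroup H] [Module ℝ H] [TopologicalSpace H] {V : Set E} (hV : CInftyOpen V)
    {Φ : E × G → H} [T2Space G]
    (hΦ : CSmoothOn (V ×ˢ univ) Φ) (u : G) {y : E} (hy : y ∈ V) :
    CSmoothAt (fun z => Φ (z, u)) y := by
  intro c t hc ht
  obtain ⟨d, hd, hdc, hdV⟩ := hc.exists_smoothCurve (hV.preimage_mem_nhds hc (by rwa [ht]))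
  refine ((hΦ (fun s => (d s, u)) (hd.prodMk (smoothCurve_const u)) fun s => ?_).at t).congr ?_
  · obtain ⟨r, hr, h⟩ := hdV s
    exact ⟨by rw [← h]; exact hr, mem_univ _⟩
  · filter_upwards [hdc] with s hs
    simp [hs]

/-- In an adapted chart, the differential of a function of `𝔄` is a smooth map into `F`, with
symmetric derivative. -/
lemma InA.exists_coord {U : Set M} (hU : 𝓜.IsOpenSet U) {f : M → ℝ} (hf : T.InA U f)
    {e : PartialEquiv M E} (he : e ∈ T.charts) :
    ∃ G : E → F, ∀ y ∈ e.target ∩ e.symm ⁻¹' U, CSmoothAt G y ∧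
      T.dflat f (e.symm y) = T.cotangentOfCoord e (e.symm y) (G y) ∧
      (∀ v, T.pairing (T.dflat f (e.symm y)) v = T.dfun f (e.symm y) v) ∧
      ∀ u v, T.pairing (cdiff G y u) v = T.pairing (cdiff G y v) u := by
  have hV := hU.cInftyOpen (T.charts_subset he)
  -- Index `k` in `InA` concerns the derivative of order `k + 1`; orders 1 and 2 suffice here.
  obtain ⟨G₀, hG₀, hG₀'⟩ := hf.2 e he 0
  obtain ⟨G₁, hG₁, hG₁'⟩ := hf.2 e he 1
  set V := e.target ∩ e.symm ⁻¹' U with hVdef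
  let G : E → F := fun y => G₀ (y, Fin.elim0)
  have hG : ∀ y ∈ V, CSmoothAt G y := fun y hy => cSmoothAt_prodMk_const hV hG₀ _ hy
  have hfe : ∀ y ∈ V, CSmoothAt (fun z => f (e.symm z)) y := fun y hy =>
    hf.1.cSmoothAt hU (T.charts_subset he) hy.1 hy.2
  have hGf : ∀ y ∈ V, ∀ v, T.pairing (G y) v = cdiff (fun z => f (e.symm z)) y v :=
    fun y hy v => hG₀' y hy _ v
  have hpair : ∀ ξ : F, ∀ A : Set E, Bornology.IsVonNBounded ℝ A →
      ∃ C : ℝ, ∀ v ∈ A, |T.pairing ξ v| ≤ C := fun ξ A hA => by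
    obtain ⟨C, hC⟩ := T.pairing_bounded {ξ} A (Set.toFinite _).isVonNBounded hA
    exact ⟨C, hC ξ rfl⟩
  have hflip : ∀ v : E, ∀ A : Set F, Bornology.IsVonNBounded ℝ A →
      ∃ C : ℝ, ∀ ξ ∈ A, |T.pairing.flip v ξ| ≤ C := fun v A hA => by
    obtain ⟨C, hC⟩ := T.pairing_bounded A {v} hA (Set.toFinite _).isVonNBounded
    exact ⟨C, fun ξ hξ => hC ξ hξ v rfl⟩
  have hκ : ∀ v, ∀ z ∈ V, CSmoothAt (fun y => T.pairing (G y) v) z := fun v z hz c t hc ht =>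
    SmoothCurveAt.linearMap_comp (T.pairing.flip v) (hflip v) (hG z hz c t hc ht)
  have hdκ : ∀ y ∈ V, ∀ u v, cdiff (fun z => T.pairing (G z) v) y u =
      T.pairing (cdiff G y u) v := by
    intro y hy u v
    have h1 := (hG y hy).hasCurveDeriv_line u
    have h2 := HasCurveDeriv.hasDerivAt_bilin T.pairing_bounded
      (hG y hy _ 0 ((smoothCurve_line y u).at 0) (by simp)) ((smoothCurve_const v).at 0) h1
      (HasCurveDeriv.const v 0)
    rw [map_zero, add_zero] at h2
    exact HasCurveDeriv.cdiff_eq (f := fun z => T.pairing (G z) v)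
      (hasCurveDeriv_iff_hasDerivAt.2 h2)
  -- The second order condition in `𝔄` supplies the smooth second derivative that the symmetry lemma
  -- requires.
  have hμ : ∀ y ∈ V, ∀ v, CSmoothAt (fun z => cdiff (fun z => T.pairing (G z) v) z v) y := by
    intro y hy v
    have h1 : CSmoothAt (fun z => T.pairing (G₁ (z, fun _ => v)) v) y := fun c t hc ht =>
      SmoothCurveAt.linearMap_comp (T.pairing.flip v) (hflip v)
        (cSmoothAt_prodMk_const hV hG₁ (fun _ => v) hy c t hc ht)
    refine h1.congr hV hy fun z hz => ?_
    rw [hG₁' z hz (fun _ => v) v]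
    exact (cdiff_congr hV hz (fun z' hz' => hGf z' hz' v) v).symm
  refine ⟨G, fun y hy => ⟨hG y hy, ?_⟩⟩
  have hs : e.symm y ∈ e.source := e.map_target hy.1
  have hc : ∀ v, T.pairing (T.cotangentOfCoord e (e.symm y) (G y)) v = T.dfun f (e.symm y) v := by
    intro v
    have hy' : e (e.symm y) = y := e.right_inv hy.1
    rw [pairing_cotangentOfCoord he hs, hGf y hy,
      dfun_eq_cdiff he hs (by rw [hy']; exact hfe y hy), hy']
  have hd := T.pairing_lift ⟨_, hc⟩
  refine ⟨T.ext_pairing fun v => (hd v).trans (hc v).symm, hd, fun u v => ?_⟩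
  rw [← hdκ y hy, ← hdκ y hy]
  exact second_cdiff_symm hV (κ := fun v z => T.pairing (G z) v) hy hfe hκ
    (fun v z hz => hGf z hz v) (hμ y hy) u v

end WeakSubbundle

end Manifold

/-! ## Anchors, Jacobiators and Schouten brackets in coordinates -/

section Anchors

variable {E : Type*} [AddCommGroup E] [Module ℝ E] [TopologicalSpace E]
  [IsTopologicalAddGroup E] [ContinuousSMul ℝ E] [LocallyConvexSpace ℝ E] [T2Space E]
variable {F : Type*} [AddCommGroup F] [Module ℝ F] [TopologicalSpace F]
  [IsTopologicalAddGroup F] [ContinuousSMul ℝ F] [LocallyConvexSpace ℝ F] [T2Space F]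
variable {M : Type*}

namespace WeakSubbundle

variable {𝓜 : ConvenientManifold E M} {T : WeakSubbundle F 𝓜}

variable (T) in
/-- The expression of the anchor `R` in the chart `e`. -/
noncomputable def anchorCoord (R : M → F →ₗ[ℝ] E) (e : PartialEquiv M E) (y : E) (ξ : F) : E :=
  T.tangentCoord e (e.symm y) (R (e.symm y) (T.cotangentOfCoord e (e.symm y) ξ))

lemma anchorCoord_add (R : M → F →ₗ[ℝ] E) {e : PartialEquiv M E} (he : e ∈ T.charts) {y : E}
    (hy : y ∈ e.target) (ξ η : F) :
    T.anchorCoord R e y (ξ + η) = T.anchorCoord R e y ξ + T.anchorCoord R e y η := by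
  have hs := e.map_target hy
  rw [anchorCoord, cotangentOfCoord_add he hs, map_add, tangentCoord_add he hs]; rfl

lemma anchorCoord_smul (R : M → F →ₗ[ℝ] E) {e : PartialEquiv M E} (he : e ∈ T.charts) {y : E}
    (hy : y ∈ e.target) (a : ℝ) (ξ : F) :
    T.anchorCoord R e y (a • ξ) = a • T.anchorCoord R e y ξ := by
  have hs := e.map_target hy
  rw [anchorCoord, cotangentOfCoord_smul he hs, map_smul, tangentCoord_smul he hs]; rfl

lemma anchorCoord_add_left (P Q : M → F →ₗ[ℝ] E) {e : PartialEquiv M E} (he : e ∈ T.charts)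
    {y : E} (hy : y ∈ e.target) (ξ : F) :
    T.anchorCoord (P + Q) e y ξ = T.anchorCoord P e y ξ + T.anchorCoord Q e y ξ :=
  tangentCoord_add he (e.map_target hy) _ _

lemma anchorCoord_chartAt (R : M → F →ₗ[ℝ] E) (x : M) (ξ : F) :
    T.anchorCoord R (T.chartAt x) (T.chartAt x x) ξ = R x ξ := by
  rw [anchorCoord, (T.chartAt x).left_inv (T.mem_chartAt_source x), cotangentOfCoord_chartAt,
    tangentCoord_chartAt]

lemma pairing_anchorCoord (R : M → F →ₗ[ℝ] E) {e : PartialEquiv M E} (he : e ∈ T.charts) {y : E}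
    (hy : y ∈ e.target) (ξ η : F) :
    T.pairing (T.cotangentOfCoord e (e.symm y) ξ)
      (R (e.symm y) (T.cotangentOfCoord e (e.symm y) η)) = T.pairing ξ (T.anchorCoord R e y η) :=
  pairing_cotangentOfCoord he (e.map_target hy) _ _

lemma IsAlmostPoissonAnchor.add {P Q : M → F →ₗ[ℝ] E} (hP : T.IsAlmostPoissonAnchor P)
    (hQ : T.IsAlmostPoissonAnchor Q) : T.IsAlmostPoissonAnchor (P + Q) := by
  refine ⟨fun e he c hc hcU => ?_, fun x ξ η => ?_⟩
  · have h : (fun p : E × F => T.anchorCoord (P + Q) e p.1 p.2) ∘ c = fun t =>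
        ((fun p : E × F => T.anchorCoord P e p.1 p.2) ∘ c) t +
        ((fun p : E × F => T.anchorCoord Q e p.1 p.2) ∘ c) t :=
      funext fun t => anchorCoord_add_left P Q he (hcU t).1 _
    change SmoothCurve ((fun p : E × F => T.anchorCoord (P + Q) e p.1 p.2) ∘ c)
    rw [h]
    exact (hP.1 e he c hc hcU).add (hQ.1 e he c hc hcU)
  · simp only [Pi.add_apply, LinearMap.add_apply, map_add, hP.2 x ξ η, hQ.2 x ξ η]
    ring

lemma IsAlmostPoissonAnchor.cSmoothAt {R : M → F →ₗ[ℝ] E} (hR : T.IsAlmostPoissonAnchor R)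
    {e : PartialEquiv M E} (he : e ∈ T.charts) {y : E} (hy : y ∈ e.target) (ξ : F) :
    CSmoothAt (fun p : E × F => T.anchorCoord R e p.1 p.2) (y, ξ) :=
  (hR.1 e he).cSmoothAt (CInftyOpen.prod_univ (T.charts_subset he).1) ⟨hy, mem_univ _⟩

lemma IsAlmostPoissonAnchor.cSmoothAt_left {R : M → F →ₗ[ℝ] E} (hR : T.IsAlmostPoissonAnchor R)
    {e : PartialEquiv M E} (he : e ∈ T.charts) {y : E} (hy : y ∈ e.target) (ξ : F) :
    CSmoothAt (fun z => T.anchorCoord R e z ξ) y :=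
  CSmoothAt.comp (f := fun z : E => (z, ξ)) (hR.cSmoothAt he hy ξ)
    ((cSmoothAt_id y).prodMk (cSmoothAt_const ξ y))

lemma chartAt_apply_mem_target (T : WeakSubbundle F 𝓜) (x : M) :
    T.chartAt x x ∈ (T.chartAt x).target :=
  (T.chartAt x).map_source (T.mem_chartAt_source x)

/-- The derivative at `x` of the anchor `R`, in the chosen chart around `x`. -/
noncomputable def anchorDeriv {R : M → F →ₗ[ℝ] E} (hR : T.IsAlmostPoissonAnchor R) (x : M) :
    E →ₗ[ℝ] F →ₗ[ℝ] E :=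
  LinearMap.mk₂ ℝ (fun v ξ => cdiff (fun y => T.anchorCoord R (T.chartAt x) y ξ) (T.chartAt x x) v)
    (fun u v ξ => (hR.cSmoothAt_left (T.chartAt_mem x) (T.chartAt_apply_mem_target x) ξ).cdiff_add
      u v)
    (fun a v ξ => (hR.cSmoothAt_left (T.chartAt_mem x) (T.chartAt_apply_mem_target x) ξ).cdiff_smul
      a v)
    (fun v ξ η => by
      rw [cdiff_congr (T.charts_subset (T.chartAt_mem x)).1 (T.chartAt_apply_mem_target x)
        (fun z hz => anchorCoord_add R (T.chartAt_mem x) hz ξ η)]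
      have h := fun ξ => (hR.cSmoothAt_left (T.chartAt_mem x)
        (T.chartAt_apply_mem_target x) ξ).hasCurveDeriv_line v
      exact HasCurveDeriv.cdiff_eq (f := fun z => T.anchorCoord R (T.chartAt x) z ξ +
        T.anchorCoord R (T.chartAt x) z η) ((h ξ).add (h η)))
    (fun a v ξ => by
      rw [cdiff_congr (T.charts_subset (T.chartAt_mem x)).1 (T.chartAt_apply_mem_target x)
        (fun z hz => anchorCoord_smul R (T.chartAt_mem x) hz a ξ)]
      exact HasCurveDeriv.cdiff_eq (f := fun z => a • T.anchorCoord R (T.chartAt x) z ξ)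
        (((hR.cSmoothAt_left (T.chartAt_mem x)
        (T.chartAt_apply_mem_target x) ξ).hasCurveDeriv_line v).const_smul a))

lemma anchorDeriv_apply {R : M → F →ₗ[ℝ] E} (hR : T.IsAlmostPoissonAnchor R) (x : M) (v : E)
    (ξ : F) : anchorDeriv hR x v ξ =
      cdiff (fun y => T.anchorCoord R (T.chartAt x) y ξ) (T.chartAt x x) v := rfl

lemma anchorDeriv_add {P Q : M → F →ₗ[ℝ] E} (hP : T.IsAlmostPoissonAnchor P)
    (hQ : T.IsAlmostPoissonAnchor Q) (x : M) :
    anchorDeriv (hP.add hQ) x = anchorDeriv hP x + anchorDeriv hQ x := by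
  ext v ξ
  simp only [LinearMap.add_apply, anchorDeriv_apply]
  rw [cdiff_congr (T.charts_subset (T.chartAt_mem x)).1 (T.chartAt_apply_mem_target x)
    (fun z hz => anchorCoord_add_left P Q (T.chartAt_mem x) hz ξ)]
  exact HasCurveDeriv.cdiff_eq (f := fun z => T.anchorCoord P (T.chartAt x) z ξ +
    T.anchorCoord Q (T.chartAt x) z ξ)
    (((hP.cSmoothAt_left (T.chartAt_mem x) (T.chartAt_apply_mem_target x)
      ξ).hasCurveDeriv_line v).add
    ((hQ.cSmoothAt_left (T.chartAt_mem x) (T.chartAt_apply_mem_target x) ξ).hasCurveDeriv_line v))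

lemma cSmoothAt_anchorCoord_comp {R : M → F →ₗ[ℝ] E} (hR : T.IsAlmostPoissonAnchor R) (x : M)
    {r : E → F} (hr : CSmoothAt r (T.chartAt x x)) :
    CSmoothAt (fun y => T.anchorCoord R (T.chartAt x) y (r y)) (T.chartAt x x) :=
  CSmoothAt.comp (f := fun y => (y, r y))
    (hR.cSmoothAt (T.chartAt_mem x) (T.chartAt_apply_mem_target x) _) ((cSmoothAt_id _).prodMk hr)

/-- The direction splits as `(v, 0) + (0, cdiff r v)`. The first part differentiates the anchor with
frozen covector; in the second the anchor at `x` is linear, hence its own derivative. -/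
lemma cdiff_anchorCoord {R : M → F →ₗ[ℝ] E} (hR : T.IsAlmostPoissonAnchor R) (x : M)
    {r : E → F} (hr : CSmoothAt r (T.chartAt x x)) (v : E) :
    cdiff (fun y => T.anchorCoord R (T.chartAt x) y (r y)) (T.chartAt x x) v =
      anchorDeriv hR x v (r (T.chartAt x x)) + R x (cdiff r (T.chartAt x x) v) := by
  set e := T.chartAt x with he
  set y := e x
  have hy : y ∈ e.target := T.chartAt_apply_mem_target x
  have hΦ := hR.cSmoothAt (T.chartAt_mem x) hy (r y)
  have hpair : cdiff (fun z => (z, r z)) y v = (v, 0) + (0, cdiff r y v) := by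
    refine HasCurveDeriv.cdiff_eq ?_
    simpa using (hasCurveDeriv_line y v 0).prodMk (hr.hasCurveDeriv_line v)
  rw [CSmoothAt.cdiff_comp (g := fun p : E × F => T.anchorCoord R e p.1 p.2)
    (f := fun z => (z, r z)) hΦ ((cSmoothAt_id _).prodMk hr), hpair, hΦ.cdiff_add]
  congr 1
  · refine HasCurveDeriv.cdiff_eq ?_
    rw [anchorDeriv_apply]
    simpa using (hR.cSmoothAt_left (T.chartAt_mem x) hy (r y)).hasCurveDeriv_line v
  · refine HasCurveDeriv.cdiff_eq ?_
    have h := hasCurveDeriv_line (R x (r y)) (R x (cdiff r y v)) 0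
    refine h.congr (Eventually.of_forall fun t => ?_)
    simp only [Prod.fst_add, Prod.smul_fst, Prod.snd_add, Prod.smul_snd, smul_zero, add_zero]
    rw [anchorCoord_chartAt, map_add, map_smul]

/-- `V` is a neighbourhood of `x` in the chosen chart around `x`, on which `s` is the expression of
the section `σ`; moreover `s` is smooth at `x`. -/
structure IsCoordAt (T : WeakSubbundle F 𝓜) (x : M) (V : Set E) (σ : M → F) (s : E → F) :
    Prop where
  isOpen : CInftyOpen V
  mem : T.chartAt x x ∈ V
  subset : V ⊆ (T.chartAt x).target
  cSmoothAt : CSmoothAt s (T.chartAt x x)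
  eq : ∀ y ∈ V, σ ((T.chartAt x).symm y) = T.cotangentOfCoord (T.chartAt x) ((T.chartAt x).symm y)
    (s y)

namespace IsCoordAt

variable {x : M} {V V' : Set E} {σ ρ : M → F} {s r : E → F}

lemma apply_self (h : T.IsCoordAt x V σ s) : s (T.chartAt x x) = σ x := by
  have := h.eq _ h.mem
  rwa [(T.chartAt x).left_inv (T.mem_chartAt_source x), cotangentOfCoord_chartAt, eq_comm] at this

lemma cdiff_fieldInChart {R : M → F →ₗ[ℝ] E} (hR : T.IsAlmostPoissonAnchor R)
    (h : T.IsCoordAt x V σ s) (v : E) :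
    cdiff (T.fieldInChart (T.chartAt x) (applySection R σ)) (T.chartAt x x) v =
      anchorDeriv hR x v (σ x) + R x (cdiff s (T.chartAt x x) v) := by
  rw [← h.apply_self, ← cdiff_anchorCoord hR x h.cSmoothAt]
  refine cdiff_congr h.isOpen h.mem (fun z hz => ?_) v
  rw [fieldInChart, applySection, h.eq z hz]; rfl

/-- The derivative of the function `⟨ρ, R σ⟩`. -/
lemma dfun_pairing {R : M → F →ₗ[ℝ] E} (hR : T.IsAlmostPoissonAnchor R)
    (hσ : T.IsCoordAt x V σ s) (hρ : T.IsCoordAt x V' ρ r) {f : M → ℝ}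
    (hf : ∀ y ∈ V ∩ V', f ((T.chartAt x).symm y) = T.pairing (ρ ((T.chartAt x).symm y))
      (R ((T.chartAt x).symm y) (σ ((T.chartAt x).symm y)))) (v : E) :
    T.dfun f x v = T.pairing (cdiff r (T.chartAt x x) v) (R x (σ x)) +
      T.pairing (ρ x) (anchorDeriv hR x v (σ x) + R x (cdiff s (T.chartAt x x) v)) := by
  have hc : ∀ y ∈ V ∩ V', (f ∘ (T.chartAt x).symm) y =
      T.pairing (r y) (T.anchorCoord R (T.chartAt x) y (s y)) := fun y hy => by
    rw [Function.comp_apply, hf y hy, hσ.eq y hy.1, hρ.eq y hy.2,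
      pairing_anchorCoord R (T.chartAt_mem x) (hσ.subset hy.1)]
  rw [dfun, cdiff_congr (hσ.isOpen.inter hρ.isOpen) ⟨hσ.mem, hρ.mem⟩ hc]
  have hs := cSmoothAt_anchorCoord_comp hR x hσ.cSmoothAt
  have hl := (smoothCurve_line (T.chartAt x x) v).at 0
  have h := HasCurveDeriv.hasDerivAt_bilin T.pairing_bounded
    (hρ.cSmoothAt _ 0 hl (by simp)) (hs _ 0 hl (by simp)) (hρ.cSmoothAt.hasCurveDeriv_line v)
    (hs.hasCurveDeriv_line v)
  simp only [zero_smul, add_zero] at h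
  rw [HasCurveDeriv.cdiff_eq (f := fun y => T.pairing (r y) (T.anchorCoord R (T.chartAt x) y (s y)))
    (hasCurveDeriv_iff_hasDerivAt.2 h), anchorCoord_chartAt, cdiff_anchorCoord hR x hσ.cSmoothAt,
    hσ.apply_self, hρ.apply_self]

/-- The terms with the derivative of `Qσ₃` occur both in `X⟨σ, Y⟩` and in `⟨σ, [X, Y]⟩` and cancel.
-/
lemma lieDerivative_eq {P Q : M → F →ₗ[ℝ] E} (hP : T.IsAlmostPoissonAnchor P)
    (hQ : T.IsAlmostPoissonAnchor Q) {V₁ V₂ V₃ : Set E} {σ₁ σ₂ σ₃ : M → F} {s₁ s₂ s₃ : E → F}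
    (h₁ : T.IsCoordAt x V₁ σ₁ s₁) (h₂ : T.IsCoordAt x V₂ σ₂ s₂) (h₃ : T.IsCoordAt x V₃ σ₃ s₃) :
    T.lieDerivative (applySection P σ₁) σ₂ (applySection Q σ₃) x =
      T.pairing (cdiff s₂ (T.chartAt x x) (P x (σ₁ x))) (Q x (σ₃ x)) +
      T.pairing (σ₂ x) (anchorDeriv hP x (Q x (σ₃ x)) (σ₁ x)) +
      T.pairing (σ₂ x) (P x (cdiff s₁ (T.chartAt x x) (Q x (σ₃ x)))) := by
  rw [lieDerivative, lieBracket, h₃.cdiff_fieldInChart hQ, h₁.cdiff_fieldInChart hP,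
    dfun_pairing hQ h₃ h₂ (fun _ _ => rfl)]
  simp only [applySection, map_add, map_sub]
  ring

end IsCoordAt

/-! ### Jacobiator and Schouten bracket as one trilinear form -/

/-- The tensor `[P̃, Q̃]`, as a form in the first order jets of `P` and `Q`. -/
def crossForm (B : F →ₗ[ℝ] E →ₗ[ℝ] ℝ) (P Q : F →ₗ[ℝ] E) (DP DQ : E →ₗ[ℝ] F →ₗ[ℝ] E)
    (ξ₁ ξ₂ ξ₃ : F) : ℝ :=
  B ξ₃ (DP (Q ξ₁) ξ₂) + B ξ₃ (DQ (P ξ₁) ξ₂) + (B ξ₁ (DP (Q ξ₂) ξ₃) + B ξ₁ (DQ (P ξ₂) ξ₃))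
    + (B ξ₂ (DP (Q ξ₃) ξ₁) + B ξ₂ (DQ (P ξ₃) ξ₁))

/-- The Schouten bracket is tensorial. -/
lemma schouten_eq_crossForm {P Q : M → F →ₗ[ℝ] E} (hP : T.IsAlmostPoissonAnchor P)
    (hQ : T.IsAlmostPoissonAnchor Q) {x : M} {V₁ V₂ V₃ : Set E} {σ₁ σ₂ σ₃ : M → F}
    {s₁ s₂ s₃ : E → F} (h₁ : T.IsCoordAt x V₁ σ₁ s₁) (h₂ : T.IsCoordAt x V₂ σ₂ s₂)
    (h₃ : T.IsCoordAt x V₃ σ₃ s₃) :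
    T.schouten P Q σ₁ σ₂ σ₃ x = crossForm T.pairing (P x) (Q x) (anchorDeriv hP x)
      (anchorDeriv hQ x) (σ₁ x) (σ₂ x) (σ₃ x) := by
  simp only [schouten, schoutenTerm, crossForm, IsCoordAt.lieDerivative_eq hP hQ h₁ h₂ h₃,
    IsCoordAt.lieDerivative_eq hP hQ h₂ h₃ h₁, IsCoordAt.lieDerivative_eq hP hQ h₃ h₁ h₂,
    IsCoordAt.lieDerivative_eq hQ hP h₁ h₂ h₃, IsCoordAt.lieDerivative_eq hQ hP h₂ h₃ h₁,
    IsCoordAt.lieDerivative_eq hQ hP h₃ h₁ h₂]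
  -- Antisymmetry moves each `cdiff` to the left slot. The derivatives of the sections then cancel
  -- between cyclic summands with `P` and `Q` exchanged, without any symmetry of these derivatives.
  simp only [hP.2 x _ (cdiff _ _ _), hQ.2 x _ (cdiff _ _ _)]
  ring

/-- The differential of a function of `𝔄` has a coordinate expression with symmetric derivative. -/
lemma InA.exists_isCoordAt {U : Set M} (hU : 𝓜.IsOpenSet U) {f : M → ℝ} (hf : T.InA U f) {x : M}
    (hx : x ∈ U) : ∃ G : E → F,
      T.IsCoordAt x ((T.chartAt x).target ∩ (T.chartAt x).symm ⁻¹' U) (T.dflat f) G ∧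
      ∀ u v, T.pairing (cdiff G (T.chartAt x x) u) v = T.pairing (cdiff G (T.chartAt x x) v) u := by
  obtain ⟨G, hG⟩ := hf.exists_coord hU (T.chartAt_mem x)
  have hmem : T.chartAt x x ∈ (T.chartAt x).target ∩ (T.chartAt x).symm ⁻¹' U :=
    ⟨T.chartAt_apply_mem_target x, by
      rwa [mem_preimage, (T.chartAt x).left_inv (T.mem_chartAt_source x)]⟩
  exact ⟨G, ⟨hU.cInftyOpen (T.charts_subset (T.chartAt_mem x)), hmem, inter_subset_left,
    (hG _ hmem).1, fun y hy => (hG y hy).2.1⟩, (hG _ hmem).2.2.2⟩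

lemma InA.pairing_dflat {U : Set M} (hU : 𝓜.IsOpenSet U) {f : M → ℝ} (hf : T.InA U f) {x : M}
    (hx : x ∈ U) (v : E) : T.pairing (T.dflat f x) v = T.dfun f x v := by
  obtain ⟨G, hG⟩ := hf.exists_coord hU (T.chartAt_mem x)
  have := (hG (T.chartAt x x) ⟨T.chartAt_apply_mem_target x, by
      rwa [mem_preimage, (T.chartAt x).left_inv (T.mem_chartAt_source x)]⟩).2.2.1 v
  rwa [(T.chartAt x).left_inv (T.mem_chartAt_source x)] at this

/-- The Leibniz rule for `⟨dh, R dg⟩` in the direction `R df`; antisymmetry of `R` accounts for the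
minus sign of the Hessian term of `g`. -/
lemma bracket_bracket_eq {R : M → F →ₗ[ℝ] E} (hR : T.IsAlmostPoissonAnchor R) {U : Set M}
    (hU : 𝓜.IsOpenSet U) (f : M → ℝ) {g h : M → ℝ} (hh : T.InA U h) {x : M} {G H : E → F}
    (hG : T.IsCoordAt x ((T.chartAt x).target ∩ (T.chartAt x).symm ⁻¹' U) (T.dflat g) G)
    (hH : T.IsCoordAt x ((T.chartAt x).target ∩ (T.chartAt x).symm ⁻¹' U) (T.dflat h) H) :
    T.bracket R f (T.bracket R g h) x =
      T.pairing (cdiff H (T.chartAt x x) (R x (T.dflat f x))) (R x (T.dflat g x)) +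
      T.pairing (T.dflat h x) (anchorDeriv hR x (R x (T.dflat f x)) (T.dflat g x)) -
      T.pairing (cdiff G (T.chartAt x x) (R x (T.dflat f x))) (R x (T.dflat h x)) := by
  rw [bracket, IsCoordAt.dfun_pairing hR hG hH, map_add, hR.2 x _ (cdiff _ _ _)]
  · ring
  · intro y hy
    exact (hh.pairing_dflat hU hy.1.2 _).symm

/-- The Jacobiator of the bracket is tensorial. -/
lemma jacobiator_eq {R : M → F →ₗ[ℝ] E} (hR : T.IsAlmostPoissonAnchor R) {U : Set M}
    (hU : 𝓜.IsOpenSet U) {f g h : M → ℝ} (hf : T.InA U f) (hg : T.InA U g) (hh : T.InA U h)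
    {x : M} (hx : x ∈ U) :
    T.bracket R f (T.bracket R g h) x + T.bracket R g (T.bracket R h f) x
        + T.bracket R h (T.bracket R f g) x =
      T.pairing (T.dflat h x) (anchorDeriv hR x (R x (T.dflat f x)) (T.dflat g x)) +
      T.pairing (T.dflat f x) (anchorDeriv hR x (R x (T.dflat g x)) (T.dflat h x)) +
      T.pairing (T.dflat g x) (anchorDeriv hR x (R x (T.dflat h x)) (T.dflat f x)) := by
  obtain ⟨F', hF, sF⟩ := hf.exists_isCoordAt hU hx
  obtain ⟨G, hG, sG⟩ := hg.exists_isCoordAt hU hx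
  obtain ⟨H, hH, sH⟩ := hh.exists_isCoordAt hU hx
  -- Each function contributes two Hessian terms of opposite sign with swapped arguments, which
  -- cancel by symmetry.
  rw [bracket_bracket_eq hR hU f hh hG hH, bracket_bracket_eq hR hU g hf hH hF,
    bracket_bracket_eq hR hU h hg hF hG, sH (R x (T.dflat f x)), sG (R x (T.dflat f x)),
    sF (R x (T.dflat g x))]
  ring

/-- The Jacobiators of `P + Q`, `P` and `Q` differ by the Schouten bracket. -/
lemma jacobiator_add {P Q : M → F →ₗ[ℝ] E} (hP : T.IsPartialPoissonAnchor P)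
    (hQ : T.IsPartialPoissonAnchor Q) {U : Set M} (hU : 𝓜.IsOpenSet U) {f g h : M → ℝ}
    (hf : T.InA U f) (hg : T.InA U g) (hh : T.InA U h) {x : M} (hx : x ∈ U) :
    T.bracket (P + Q) f (T.bracket (P + Q) g h) x + T.bracket (P + Q) g (T.bracket (P + Q) h f) x
        + T.bracket (P + Q) h (T.bracket (P + Q) f g) x =
      crossForm T.pairing (P x) (Q x) (anchorDeriv hP.1 x) (anchorDeriv hQ.1 x)
        (T.dflat f x) (T.dflat g x) (T.dflat h x) := by
  have jP := hP.2 U hU f g h hf hg hh x hx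
  have jQ := hQ.2 U hU f g h hf hg hh x hx
  rw [jacobiator_eq hP.1 hU hf hg hh hx] at jP
  rw [jacobiator_eq hQ.1 hU hf hg hh hx] at jQ
  -- Polarization: the derivative of the anchor is additive in it, so the pure terms are the
  -- vanishing Jacobiators and the mixed terms form `crossForm`.
  rw [jacobiator_eq (hP.1.add hQ.1) hU hf hg hh hx, anchorDeriv_add hP.1 hQ.1]
  simp only [crossForm, Pi.add_apply, LinearMap.add_apply, map_add]
  linear_combination jP + jQ

/-- The values at `x` of the differentials of functions of `𝔄`. -/
def differentialsAt (T : WeakSubbundle F 𝓜) (x : M) : Set F :=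
  {ξ | ∃ (W : Set M) (f : M → ℝ), 𝓜.IsOpenSet W ∧ x ∈ W ∧ T.InA W f ∧ ξ = T.dflat f x}

/-- Since the bracket is tensorial, only the value of a section at `x`, a combination of
differentials, matters; a smooth coordinate expression is needed to apply that fact. -/
lemma InP.exists_isCoordAt {U : Set M} {σ : M → F} (hσ : T.InP U σ) {x : M} (hx : x ∈ U) :
    σ x ∈ Submodule.span ℝ (T.differentialsAt x) ∧ ∃ V s, T.IsCoordAt x V σ s := by
  obtain ⟨W, hW, hxW, -, n, a, f, ha, hf, hσW⟩ := hσ x hx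
  have he := T.chartAt_mem x
  have hsym := (T.chartAt x).left_inv (T.mem_chartAt_source x)
  refine ⟨?_, ?_⟩
  · rw [hσW x hxW]
    exact Submodule.sum_mem _ fun i _ => Submodule.smul_mem _ _
      (Submodule.subset_span ⟨W, f i, hW, hxW, hf i, rfl⟩)
  choose G hG _ using fun i => (hf i).exists_isCoordAt hW hxW
  refine ⟨(T.chartAt x).target ∩ (T.chartAt x).symm ⁻¹' W,
    fun y => ∑ i, a i ((T.chartAt x).symm y) • G i y,
    hW.cInftyOpen (T.charts_subset he), ⟨T.chartAt_apply_mem_target x, ?_⟩, inter_subset_left,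
    CSmoothAt.sum _ fun i => CSmoothAt.smul ?_ (hG i).cSmoothAt, fun y hy => ?_⟩
  · rwa [mem_preimage, hsym]
  · exact (ha i).1.cSmoothAt hW (T.charts_subset he) (T.chartAt_apply_mem_target x) (by rwa [hsym])
  · have hs := (T.chartAt x).map_target hy.1
    rw [hσW _ hy.2, cotangentOfCoord_sum he hs]
    refine Finset.sum_congr rfl fun i _ => ?_
    rw [cotangentOfCoord_smul he hs, (hG i).eq y hy]

lemma InA.inP_dflat {U : Set M} (hU : 𝓜.IsOpenSet U) {f : M → ℝ} (hf : T.InA U f) :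
    T.InP U (T.dflat f) := fun _ hx =>
  ⟨U, hU, hx, Subset.rfl, 1, fun _ _ => 1, fun _ => f, fun _ => inA_const U 1, fun _ => hf,
    fun y _ => by simp⟩

/-- The form is invariant under cyclic permutations, so linearity in the last slot is used three
times. -/
lemma crossForm_eq_zero_of_span {B : F →ₗ[ℝ] E →ₗ[ℝ] ℝ} {P Q : F →ₗ[ℝ] E}
    {DP DQ : E →ₗ[ℝ] F →ₗ[ℝ] E} {S : Set F}
    (h : ∀ ξ₁ ∈ S, ∀ ξ₂ ∈ S, ∀ ξ₃ ∈ S, crossForm B P Q DP DQ ξ₁ ξ₂ ξ₃ = 0) {ξ₁ ξ₂ ξ₃ : F}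
    (h₁ : ξ₁ ∈ Submodule.span ℝ S) (h₂ : ξ₂ ∈ Submodule.span ℝ S)
    (h₃ : ξ₃ ∈ Submodule.span ℝ S) : crossForm B P Q DP DQ ξ₁ ξ₂ ξ₃ = 0 := by
  have cyc : ∀ a b c, crossForm B P Q DP DQ a b c = crossForm B P Q DP DQ b c a := fun a b c => by
    simp only [crossForm]; ring
  have step : ∀ a b, (∀ c ∈ S, crossForm B P Q DP DQ a b c = 0) →
      ∀ c ∈ Submodule.span ℝ S, crossForm B P Q DP DQ a b c = 0 := by
    intro a b hab c hc
    induction hc using Submodule.span_induction with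
    | mem c hc => exact hab c hc
    | zero => simp [crossForm]
    | add c d _ _ hc hd =>
      simp only [crossForm, map_add, LinearMap.add_apply] at hc hd ⊢
      linear_combination hc + hd
    | smul r c _ hc =>
      simp only [crossForm, map_smul, LinearMap.smul_apply, smul_eq_mul] at hc ⊢
      linear_combination r * hc
  refine step ξ₁ ξ₂ (fun c hc => ?_) ξ₃ h₃
  rw [← cyc]
  refine step c ξ₁ (fun b hb => ?_) ξ₂ h₂
  rw [← cyc]
  exact step b c (fun a ha => h b hb c hc a ha) ξ₁ h₁

end WeakSubbundle

end Anchors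

/-! ### The equivalence -/

theorem mainTheorem1
    {E : Type*} [AddCommGroup E] [Module ℝ E] [TopologicalSpace E] [ConvenientSpace E]
    {F : Type*} [AddCommGroup F] [Module ℝ F] [TopologicalSpace F] [ConvenientSpace F]
    {M : Type*} (𝓜 : ConvenientManifold E M) (T : WeakSubbundle F 𝓜)
    (P Q : M → F →ₗ[ℝ] E)
    (hP : T.IsPartialPoissonAnchor P) (hQ : T.IsPartialPoissonAnchor Q) :
    T.Compatible P Q ↔ T.SchoutenVanishes P Q := by
  constructor
  · intro hPQ U _ σ₁ σ₂ σ₃ h₁ h₂ h₃ x hx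
    obtain ⟨m₁, V₁, s₁, c₁⟩ := h₁.exists_isCoordAt hx
    obtain ⟨m₂, V₂, s₂, c₂⟩ := h₂.exists_isCoordAt hx
    obtain ⟨m₃, V₃, s₃, c₃⟩ := h₃.exists_isCoordAt hx
    rw [WeakSubbundle.schouten_eq_crossForm hP.1 hQ.1 c₁ c₂ c₃]
    refine WeakSubbundle.crossForm_eq_zero_of_span ?_ m₁ m₂ m₃
    rintro _ ⟨W₁, f, hW₁, hx₁, hf, rfl⟩ _ ⟨W₂, g, hW₂, hx₂, hg, rfl⟩ _ ⟨W₃, h, hW₃, hx₃, hh, rfl⟩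
    -- The three functions live on different neighbourhoods of `x`; the Jacobi identity is applied
    -- on the intersection.
    have hW : 𝓜.IsOpenSet (W₁ ∩ W₂ ∩ W₃) := (hW₁.inter hW₂).inter hW₃
    have hxW : x ∈ W₁ ∩ W₂ ∩ W₃ := ⟨⟨hx₁, hx₂⟩, hx₃⟩
    have hf' : T.InA (W₁ ∩ W₂ ∩ W₃) f := hf.mono fun _ h => h.1.1
    have hg' : T.InA (W₁ ∩ W₂ ∩ W₃) g := hg.mono fun _ h => h.1.2
    have hh' : T.InA (W₁ ∩ W₂ ∩ W₃) h := hh.mono fun _ h => h.2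
    rw [← WeakSubbundle.jacobiator_add hP hQ hW hf' hg' hh' hxW]
    exact hPQ.2 _ hW f g h hf' hg' hh' x hxW
  · intro hS
    refine ⟨hP.1.add hQ.1, fun U hU f g h hf hg hh x hx => ?_⟩
    obtain ⟨_, cf, _⟩ := hf.exists_isCoordAt hU hx
    obtain ⟨_, cg, _⟩ := hg.exists_isCoordAt hU hx
    obtain ⟨_, ch, _⟩ := hh.exists_isCoordAt hU hx
    rw [WeakSubbundle.jacobiator_add hP hQ hU hf hg hh hx,
      ← WeakSubbundle.schouten_eq_crossForm hP.1 hQ.1 cf cg ch]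
    exact hS U hU _ _ _ (hf.inP_dflat hU) (hg.inP_dflat hU) (hh.inP_dflat hU) x hx
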